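/- There are absolute constants $c_2>0$, $\gamma_2>0$ and $m_0\in\mathbb N$ such that the following holds for all integers $m\ge m_0$ and $n$ with $$m\le\Big(\frac{n}{c_2\log(545m)}\Big)^{8/7}.$$ Let $a_1,\dots,a_m$ be random vectors in $\mathbb C^n$ whose entries are all i.i.d. standard complex Gaussian, that is, distributed as $(\alpha+i\beta)/\sqrt2$ with $\alpha,\beta$ independent standard real Gaussians. Let $\mathcal H_n$ be the real vector space of Hermitian $n\times n$ matrices, let $\langle B,D\rangle_F=\operatorname{tr}(BD^*)$, and let $\mathcal A:\mathcal H_n\to\mathbb R^m$ be given by $\mathcal A(X)_j=\langle a_ja_j^*,X\rangle_F$. Then with probability at least $1-14e^{-\gamma_2m^{7/8}}$ the following holds for all $\kappa>0$ simultaneously: the scaled operator $\frac1{\sqrt m}\mathcal A$ has the $S_1$-quotient property relative to $\|\cdot\|_2$ with rank $r_*=\kappa m/n$ and constant $d=\frac{128\sqrt2}{\kappa}\sqrt{\kappa m/n}$. Here a linear operator $\mathcal B:\mathcal H_n\to\mathbb R^m$ has the $S_q$-quotient property ($q\ge1$) with constant $d$ and rank $r_*$ relative to a norm $\|\cdot\|$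 on $\mathbb R^m$ if for every $w\in\mathbb R^m$ there is $U\in\mathcal H_n$ with $\mathcal BU=w$ and $\|U\|_{S_q}\le d\,r_*^{1/q-1/2}\|w\|$, where $\|U\|_{S_q}$ is the $\ell_q$ norm of the vector of singular values of $U$. -/

import Mathlib

open MeasureTheory ProbabilityTheory
open scoped ENNReal

noncomputable section

/-- The real vector space of Hermitian `n × n` complex matrices. -/
abbrev HermitianMatrix (n : ℕ) : Type :=
  selfAdjoint (Matrix (Fin n) (Fin n) ℂ)

/-- The Frobenius product `⟨B, D⟩ = tr (B D*)`. -/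
def frobeniusInner {n : ℕ} (B D : Matrix (Fin n) (Fin n) ℂ) : ℂ :=
  (B * D.conjTranspose).trace

/-- The rank-one matrix `v v*`. -/
def rankOne {n : ℕ} (v : Fin n → ℂ) : Matrix (Fin n) (Fin n) ℂ :=
  Matrix.vecMulVec v (star v)

/-- The singular values of a square matrix, in decreasing order. -/
def matrixSingularValues {n : ℕ} (X : Matrix (Fin n) (Fin n) ℂ) : Fin n → ℝ :=
  fun i => X.toEuclideanLin.singularValues i

/-- The Schatten-`q` norm: the `ℓ_q` norm of the vector of singular values. -/
def schattenNorm {n : ℕ} (q : ℝ≥0∞) (X : Matrix (Fin n) (Fin n) ℂ) : ℝ :=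
  ‖WithLp.toLp q (matrixSingularValues X)‖

/-- The measurement operator `X ↦ (⟨a_j a_j*, X⟩)_j` on Hermitian matrices; `ℝ^m` carries the
`ℓ₂` norm. The Frobenius products are real, see `frobeniusInner_rankOne_hermitian`, so taking the
real part only changes the type. -/
def measurementOperator {m n : ℕ} (a : Fin m → Fin n → ℂ) :
    HermitianMatrix n →ₗ[ℝ] EuclideanSpace ℝ (Fin m) where
  toFun X := WithLp.toLp 2 fun j =>
    (frobeniusInner (rankOne (a j)) (X : Matrix (Fin n) (Fin n) ℂ)).re
  map_add' X Y := by
    ext j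
    simp [frobeniusInner, Matrix.mul_add]
  map_smul' c X := by
    ext j
    simp [frobeniusInner]

theorem frobeniusInner_rankOne_hermitian {n : ℕ} (v : Fin n → ℂ) (X : HermitianMatrix n) :
    (frobeniusInner (rankOne v) (X : Matrix (Fin n) (Fin n) ℂ)).im = 0 := by
  have hX : (X : Matrix (Fin n) (Fin n) ℂ).conjTranspose = X := X.2
  rw [← Complex.conj_eq_iff_im]
  have h := Matrix.trace_conjTranspose (rankOne v * (X : Matrix (Fin n) (Fin n) ℂ))
  have hr : (rankOne v).conjTranspose = rankOne v := by
    simp [rankOne, Matrix.conjTranspose_vecMulVec]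
  rw [Matrix.conjTranspose_mul, hX, hr, Matrix.trace_mul_comm] at h
  rw [frobeniusInner, hX]
  exact h.symm

/-- The `S_q`-quotient property with constant `d` and rank `r` relative to the norm of `F`
(where `F` is `ℝ^m` with the norm in question): every `w` is the image of some Hermitian `U`
with `‖U‖_{S_q} ≤ d r^{1/q - 1/2} ‖w‖`. -/
def HasQuotientProperty {n : ℕ} {F : Type*} [NormedAddCommGroup F] [NormedSpace ℝ F]
    (q : ℝ≥0∞) (d r : ℝ) (A : HermitianMatrix n →ₗ[ℝ] F) : Prop :=
  ∀ w : F, ∃ U : HermitianMatrix n, A U = w ∧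
    schattenNorm q (U : Matrix (Fin n) (Fin n) ℂ) ≤ d * r ^ (q.toReal⁻¹ - 1 / 2 : ℝ) * ‖w‖

/-- The standard complex Gaussian distribution: the law of `(α + i β) / √2` for independent
standard real Gaussian `α` and `β`. -/
def stdComplexGaussian : Measure ℂ :=
  ((gaussianReal 0 1).prod (gaussianReal 0 1)).map
    fun p : ℝ × ℝ => ((p.1 : ℂ) + Complex.I * (p.2 : ℂ)) / ((Real.sqrt 2 : ℝ) : ℂ)

end

/-! For given `w`, look for `U = ∑ v_j a_j a_j*`. Its trace norm is at most `∑ |v_j| ‖a_j‖²`, hence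
at most `2n √m ‖v‖` when all `‖a_j‖² ≤ 2n`, and `𝒜 U = G v` with the Gram matrix `G_{jk} = |⟨a_j,
a_k⟩|²`. So it is enough that `G` has smallest eigenvalue at least `n²/36`
(`exists_measurement_eq`). Replacing `a_j a_j*` by its traceless part `X_j` subtracts a positive
semidefinite rank-one matrix from `G`, so the goal becomes `‖∑ v_j X_j‖ ≥ (n/6) ‖v‖`.

The sphere is replaced by a grid of mesh `1/(40m)`, which has at most `exp(m L)` points, `L =
log(545m)`. For a grid vector `w`, the coordinates are cut into blocks of size at most `s =
⌈m^{7/8}⌉`: the coordinates with `w_j² > 1/s` form the initial block, the rest are cut along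
intervals. Within a block Gershgorin's bound applies, because with high probability no `a_j` is
strongly correlated with any `s` of the others (`IsWellSpread.mul_sum_sq_le`). Between blocks, the
next block is independent of the partial sum `S` before it. As `S` has trace zero, `⟨S/‖S‖, ∑ w_j
a_j a_j*⟩` is a centred quadratic form in Gaussians, and the small coefficients `|w_j| ≤ 1/√s` give
a tail strong enough for the union bound over the grid (`gaussianVectors_block_inner_lt_le`). Almost
orthogonal blocks then add up with a bounded loss (`half_sum_sub_le_norm_sq`).

The block size balances two demands: `s log m ≲ n` for the union over small sets, and `s^{3/2} n ≳
m² log m` for the grid. Both hold for `s ≈ m^{7/8}` and `n ≳ m^{7/8} log m`. -/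

/-! ### Exponential moments and Chernoff bounds -/

theorem one_div_one_sub_le_exp {x : ℝ} (hx : |x| ≤ 1 / 2) :
    1 / (1 - x) ≤ Real.exp (x + x ^ 2) := by
  obtain ⟨h1, h2⟩ := abs_le.1 hx
  rw [div_le_iff₀ (by linarith)]
  rcases le_total 0 x with h | h
  · have := Real.quadratic_le_exp_of_nonneg (x := x + x ^ 2) (by positivity)
    nlinarith [mul_le_mul_of_nonneg_right this (by linarith : (0 : ℝ) ≤ 1 - x), pow_nonneg h 2,
      pow_nonneg h 3, mul_nonneg (pow_nonneg h 2) (by nlinarith [pow_nonneg h 2] :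
        (0 : ℝ) ≤ 1 - x - x ^ 2 - x ^ 3)]
  · have h3 := Real.le_log_one_add_of_nonneg (x := -x) (by linarith)
    have h4 : -(x + x ^ 2) ≤ 2 * -x / (-x + 2) := by
      rw [le_div_iff₀ (by linarith)]
      nlinarith [sq_nonneg x, mul_nonneg (sq_nonneg x) (by linarith : (0 : ℝ) ≤ 1 + x)]
    have h5 : Real.exp (-(x + x ^ 2)) ≤ 1 - x := by
      rw [← Real.le_log_iff_exp_le (by linarith)]
      simpa [sub_eq_add_neg] using h4.trans h3
    calc (1 : ℝ) = Real.exp (x + x ^ 2) * Real.exp (-(x + x ^ 2)) := by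
          rw [← Real.exp_add]; simp
      _ ≤ _ := by gcongr

theorem lintegral_exp_mul_sq_gaussianReal {c : ℝ} (hc : c < 1) :
    ∫⁻ x, ENNReal.ofReal (Real.exp (c * (x ^ 2 / 2))) ∂(gaussianReal 0 1)
      = ENNReal.ofReal (Real.sqrt (1 / (1 - c))) := by
  have hc' : 0 < 1 - c := by linarith
  -- Tilting the standard Gaussian density by `exp(c x²/2)` gives `√v` times the centred Gaussian
  -- density of variance `v = 1/(1-c)`.
  set v : NNReal := ⟨1 / (1 - c), by positivity⟩ with hv
  have hvr : (v : ℝ) = 1 / (1 - c) := rfl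
  have hv0 : v ≠ 0 := by
    rw [← NNReal.coe_ne_zero, hvr]
    positivity
  have key (x : ℝ) : gaussianPDFReal 0 1 x * Real.exp (c * (x ^ 2 / 2))
      = Real.sqrt (1 / (1 - c)) * gaussianPDFReal 0 v x := by
    have h1 : Real.sqrt (1 / (1 - c)) ≠ 0 := by positivity
    have h2 : Real.exp (-(x - 0) ^ 2 / (2 * (1 / (1 - c))))
        = Real.exp (-(x - 0) ^ 2 / 2) * Real.exp (c * (x ^ 2 / 2)) := by
      rw [← Real.exp_add]
      congr 1
      field_simp
      ring
    rw [gaussianPDFReal, gaussianPDFReal, hvr, NNReal.coe_one, mul_one, mul_one,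
      Real.sqrt_mul (by positivity) (1 / (1 - c)), h2]
    field_simp
  rw [gaussianReal_of_var_ne_zero 0 one_ne_zero,
    lintegral_withDensity_eq_lintegral_mul _ (measurable_gaussianPDF 0 1) (by fun_prop)]
  simp_rw [Pi.mul_apply, gaussianPDF, ← ENNReal.ofReal_mul (gaussianPDFReal_nonneg _ _ _), key,
    ENNReal.ofReal_mul (Real.sqrt_nonneg _)]
  rw [lintegral_const_mul _ (by fun_prop), lintegral_gaussianPDFReal_eq_one 0 hv0, mul_one]

instance : IsProbabilityMeasure stdComplexGaussian := by
  rw [stdComplexGaussian]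
  exact Measure.isProbabilityMeasure_map (by fun_prop)

theorem lintegral_exp_mul_norm_sq_stdComplexGaussian {c : ℝ} (hc : c < 1) :
    ∫⁻ z, ENNReal.ofReal (Real.exp (c * ‖z‖ ^ 2)) ∂stdComplexGaussian
      = ENNReal.ofReal (1 / (1 - c)) := by
  have hn (p : ℝ × ℝ) : ‖((p.1 : ℂ) + Complex.I * (p.2 : ℂ)) / ((Real.sqrt 2 : ℝ) : ℂ)‖ ^ 2
      = p.1 ^ 2 / 2 + p.2 ^ 2 / 2 := by
    rw [norm_div, div_pow, Complex.norm_real, Real.norm_eq_abs, sq_abs,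
      Real.sq_sqrt (by norm_num), mul_comm Complex.I, Complex.sq_norm, Complex.normSq_add_mul_I]
    ring
  rw [stdComplexGaussian, lintegral_map (by fun_prop) (by fun_prop)]
  simp_rw [hn, mul_add, Real.exp_add, ENNReal.ofReal_mul (Real.exp_nonneg _)]
  rw [lintegral_prod_mul (f := fun x : ℝ => ENNReal.ofReal (Real.exp (c * (x ^ 2 / 2))))
    (g := fun x : ℝ => ENNReal.ofReal (Real.exp (c * (x ^ 2 / 2)))) (by fun_prop) (by fun_prop),
    lintegral_exp_mul_sq_gaussianReal hc, ← ENNReal.ofReal_mul (Real.sqrt_nonneg _),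
    Real.mul_self_sqrt (by simp only [one_div, inv_nonneg]; linarith)]

/-- Exponential moments of a sum tensorize: each summand `F k` may depend on all coordinates
outside `I`, but among those in `I` only on the `k`-th one. -/
theorem lintegral_exp_sum_le_of_update {ι : Type*} [Fintype ι] [DecidableEq ι] {X : Type*}
    [MeasurableSpace X] (μ : Measure X) [IsProbabilityMeasure μ]
    (F : ι → (ι → X) → ℝ) (hF : ∀ k, Measurable (F k)) (C : ι → ℝ) (I : Finset ι)
    (hloc : ∀ k ∈ I, ∀ j ∈ I, j ≠ k → ∀ x y, F k (Function.update x j y) = F k x)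
    (hC : ∀ k ∈ I, ∀ x, ∫⁻ y, ENNReal.ofReal (Real.exp (F k (Function.update x k y))) ∂μ
      ≤ ENNReal.ofReal (Real.exp (C k))) :
    ∫⁻ x, ENNReal.ofReal (Real.exp (∑ k ∈ I, F k x)) ∂(Measure.pi fun _ : ι => μ)
      ≤ ENNReal.ofReal (Real.exp (∑ k ∈ I, C k)) := by
  -- This is a conditional form, with the coordinates outside `I` frozen, so that induction on `I`
  -- can go through.
  have key : ∀ x, (∫⋯∫⁻_I, (fun x => ENNReal.ofReal (Real.exp (∑ k ∈ I, F k x)))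
      ∂(fun _ : ι => μ)) x ≤ ENNReal.ofReal (Real.exp (∑ k ∈ I, C k)) := by
    induction I using Finset.induction_on with
    | empty => intro x; simp
    | insert i s hi ih =>
      intro x
      -- Coordinate `i` is integrated out innermost: by locality only the factor of `F i` sees it,
      -- and `hC` bounds that factor whatever the other coordinates are.
      rw [lmarginal_insert' _ (by fun_prop) hi]
      have hstep : (fun x : ι → X => ∫⁻ y, ENNReal.ofReal
          (Real.exp (∑ k ∈ insert i s, F k (Function.update x i y))) ∂μ)
          ≤ fun x => ENNReal.ofReal (Real.exp (C i)) *
            ENNReal.ofReal (Real.exp (∑ k ∈ s, F k x)) := by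
        intro x
        have h (y : X) : ∑ k ∈ s, F k (Function.update x i y) = ∑ k ∈ s, F k x :=
          Finset.sum_congr rfl fun k hk => hloc k (Finset.mem_insert_of_mem hk) i
            (Finset.mem_insert_self i s) (fun h => hi (h ▸ hk)) x y
        simp only [Finset.sum_insert hi, h, Real.exp_add,
          ENNReal.ofReal_mul (Real.exp_nonneg _)]
        rw [lintegral_mul_const _ (by fun_prop)]
        gcongr
        exact hC i (Finset.mem_insert_self i s) x
      refine (lmarginal_mono hstep x).trans ?_
      rw [lmarginal, lintegral_const_mul _ (by fun_prop), Finset.sum_insert hi, Real.exp_add,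
        ENNReal.ofReal_mul (Real.exp_nonneg _)]
      gcongr
      exact ih (fun k hk j hj => hloc k (Finset.mem_insert_of_mem hk) j
        (Finset.mem_insert_of_mem hj)) (fun k hk => hC k (Finset.mem_insert_of_mem hk)) x
  refine (lintegral_le_of_lmarginal_le I (by fun_prop) (g := fun _ =>
    ENNReal.ofReal (Real.exp (∑ k ∈ I, C k))) (by fun_prop) fun x => ?_).trans (by simp)
  refine (key x).trans (le_of_eq ?_)
  rw [lmarginal]
  simp

/-- Markov's inequality for the exponential of the sum. The summands need not be independent, only
local within `I`; this is how conditioning on the remaining vectors is carried out later. -/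
theorem measure_le_sum_le_of_update {ι : Type*} [Fintype ι] [DecidableEq ι] {X : Type*}
    [MeasurableSpace X] (μ : Measure X) [IsProbabilityMeasure μ]
    (F : ι → (ι → X) → ℝ) (hF : ∀ k, Measurable (F k)) (C : ι → ℝ) (I : Finset ι)
    (hloc : ∀ k ∈ I, ∀ j ∈ I, j ≠ k → ∀ x y, F k (Function.update x j y) = F k x)
    (hC : ∀ k ∈ I, ∀ x, ∫⁻ y, ENNReal.ofReal (Real.exp (F k (Function.update x k y))) ∂μ
      ≤ ENNReal.ofReal (Real.exp (C k))) (R : ℝ) :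
    (Measure.pi fun _ : ι => μ) {x | R ≤ ∑ k ∈ I, F k x}
      ≤ ENNReal.ofReal (Real.exp (∑ k ∈ I, C k - R)) := by
  have h := mul_meas_ge_le_lintegral (μ := Measure.pi fun _ : ι => μ)
    (f := fun x => ENNReal.ofReal (Real.exp (∑ k ∈ I, F k x))) (by fun_prop)
    (ENNReal.ofReal (Real.exp R))
  have h2 := h.trans (lintegral_exp_sum_le_of_update μ F hF C I hloc hC)
  have hset : {x | R ≤ ∑ k ∈ I, F k x} = {x | ENNReal.ofReal (Real.exp R)
      ≤ ENNReal.ofReal (Real.exp (∑ k ∈ I, F k x))} := by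
    ext x
    simp [ENNReal.ofReal_le_ofReal_iff (Real.exp_nonneg _)]
  rw [hset, Real.exp_sub, ENNReal.ofReal_div_of_pos (Real.exp_pos _),
    ENNReal.le_div_iff_mul_le (by simp [Real.exp_pos]) (by simp), mul_comm]
  exact h2

theorem lintegral_exp_sum_norm_sq_le {ι : Type*} [Fintype ι] {c : ι → ℝ}
    (hc : ∀ i, |c i| ≤ 1 / 2) :
    ∫⁻ z, ENNReal.ofReal (Real.exp (∑ i, c i * ‖z i‖ ^ 2))
        ∂(Measure.pi fun _ : ι => stdComplexGaussian)
      ≤ ENNReal.ofReal (Real.exp (∑ i, (c i + c i ^ 2))) := by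
  classical
  refine lintegral_exp_sum_le_of_update stdComplexGaussian
    (fun i z => c i * ‖z i‖ ^ 2) (fun k => by fun_prop) _ Finset.univ ?_ ?_
  · intro k _ j _ hjk x y
    simp [Function.update_of_ne hjk.symm]
  · intro k _ x
    simp only [Function.update_self]
    rw [lintegral_exp_mul_norm_sq_stdComplexGaussian (by linarith [(abs_le.1 (hc k)).2])]
    exact ENNReal.ofReal_le_ofReal (one_div_one_sub_le_exp (hc k))

/-! ### Rotation invariance and Hermitian quadratic forms of one Gaussian vector -/

theorem charFun_stdComplexGaussian (t : ℂ) :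
    charFun stdComplexGaussian t = Complex.exp (-(‖t‖ : ℂ) ^ 2 / 4) := by
  have hs : ((Real.sqrt 2 : ℝ) : ℂ) ^ 2 = 2 := by
    rw [← Complex.ofReal_pow, Real.sq_sqrt (by norm_num)]
    norm_num
  have hs0 : ((Real.sqrt 2 : ℝ) : ℂ) ≠ 0 := by
    intro h
    rw [h] at hs
    norm_num at hs
  have hi (p : ℝ × ℝ) : Complex.exp
      ((inner ℝ (((p.1 : ℂ) + Complex.I * (p.2 : ℂ)) / ((Real.sqrt 2 : ℝ) : ℂ)) t : ℝ) * Complex.I)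
      = Complex.exp ((t.re / Real.sqrt 2 : ℝ) * p.1 * Complex.I)
        * Complex.exp ((t.im / Real.sqrt 2 : ℝ) * p.2 * Complex.I) := by
    rw [← Complex.exp_add, ← add_mul, Complex.inner]
    congr 2
    norm_cast
    simp [Complex.mul_re, Complex.div_ofReal_re, Complex.div_ofReal_im]
    ring
  rw [charFun_apply, stdComplexGaussian, integral_map (by fun_prop)
    (Measurable.aestronglyMeasurable (by fun_prop))]
  simp_rw [hi]
  rw [integral_prod_mul (fun x : ℝ => Complex.exp ((t.re / Real.sqrt 2 : ℝ) * x * Complex.I))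
    (fun x : ℝ => Complex.exp ((t.im / Real.sqrt 2 : ℝ) * x * Complex.I)),
    ← charFun_apply_real, ← charFun_apply_real, charFun_gaussianReal, charFun_gaussianReal,
    ← Complex.exp_add]
  congr 1
  have h2 : (‖t‖ : ℂ) ^ 2 = (t.re : ℂ) ^ 2 + (t.im : ℂ) ^ 2 := by
    rw [← Complex.ofReal_pow, Complex.sq_norm, Complex.normSq_apply]
    push_cast
    ring
  rw [h2]
  push_cast
  field_simp
  rw [hs]
  ring

/-- The standard complex Gaussian vector is invariant under isometries. -/
theorem map_stdComplexGaussian_linearIsometryEquiv {n : ℕ}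
    (f : EuclideanSpace ℂ (Fin n) ≃ₗᵢ[ℝ] EuclideanSpace ℂ (Fin n)) :
    ((Measure.pi fun _ : Fin n => stdComplexGaussian).map (WithLp.toLp 2)).map f
      = (Measure.pi fun _ : Fin n => stdComplexGaussian).map (WithLp.toLp 2) := by
  have hc (t : EuclideanSpace ℂ (Fin n)) :
      charFun ((Measure.pi fun _ : Fin n => stdComplexGaussian).map (WithLp.toLp 2)) t
        = Complex.exp (-(‖t‖ : ℂ) ^ 2 / 4) := by
    rw [charFun_pi]
    simp_rw [charFun_stdComplexGaussian]
    rw [← Complex.exp_sum, ← Complex.ofReal_pow ‖t‖, EuclideanSpace.norm_sq_eq]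
    push_cast
    rw [← Finset.sum_div, Finset.sum_neg_distrib]
  have : IsProbabilityMeasure
      ((Measure.pi fun _ : Fin n => stdComplexGaussian).map (WithLp.toLp 2)) :=
    Measure.isProbabilityMeasure_map (by fun_prop)
  have : IsProbabilityMeasure
      (((Measure.pi fun _ : Fin n => stdComplexGaussian).map (WithLp.toLp 2)).map f) :=
    Measure.isProbabilityMeasure_map (by fun_prop)
  apply Measure.ext_of_charFun
  ext t
  rw [hc, charFun_apply, integral_map (by fun_prop)
    (Measurable.aestronglyMeasurable (by fun_prop))]
  have (x : EuclideanSpace ℂ (Fin n)) : inner ℝ (f x) t = inner ℝ x (f.symm t) := by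
    rw [← f.inner_map_map x, f.apply_symm_apply]
  simp_rw [this]
  rw [← charFun_apply, hc, f.symm.norm_map]

/-- The vectorization of the rank-one matrix `a a*`. -/
noncomputable def vecRankOne {n : ℕ} (a : Fin n → ℂ) : EuclideanSpace ℂ (Fin n × Fin n) :=
  WithLp.toLp 2 fun p => a p.1 * star (a p.2)

/-- The vectorized Hermitian matrices whose trace is at most `τ` in absolute value. -/
def IsVecHermitian {n : ℕ} (τ : ℝ) (D : EuclideanSpace ℂ (Fin n × Fin n)) : Prop :=
  (∀ i j, D (j, i) = star (D (i, j))) ∧ |∑ i, (D (i, i)).re| ≤ τ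

/-- The spectral theorem, with the trace and the Frobenius norm read off from the eigenvalues. The
coordinates of a Gaussian vector in the eigenbasis are again i.i.d. Gaussian, so only these two
quantities enter the moment bound. -/
theorem exists_diagonalization {n : ℕ} {τ : ℝ} {D : EuclideanSpace ℂ (Fin n × Fin n)}
    (hD : IsVecHermitian τ D) :
    ∃ (b : EuclideanSpace ℂ (Fin n) ≃ₗᵢ[ℂ] EuclideanSpace ℂ (Fin n)) (l : Fin n → ℝ),
      |∑ i, l i| ≤ τ ∧ ∑ i, l i ^ 2 = ‖D‖ ^ 2 ∧
      ∀ a : Fin n → ℂ, inner ℝ D (vecRankOne a) = ∑ i, l i * ‖b (WithLp.toLp 2 a) i‖ ^ 2 := by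
  set A : Matrix (Fin n) (Fin n) ℂ := Matrix.of fun i j => D (i, j) with hAdef
  have hA : A.IsHermitian := by
    ext i j
    simp [hAdef, Matrix.conjTranspose_apply, hD.1 j i]
  refine ⟨hA.eigenvectorBasis.repr, hA.eigenvalues, ?_, ?_, ?_⟩
  · have h := congrArg Complex.re hA.trace_eq_sum_eigenvalues
    simp only [Matrix.trace, Matrix.diag_apply, hAdef, Matrix.of_apply, Complex.re_sum] at h
    have h2 := hD.2
    rw [h] at h2
    simpa using h2
  · have h1 : (A * A).trace = ((∑ i, hA.eigenvalues i ^ 2 : ℝ) : ℂ) := by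
      conv_lhs => rw [hA.spectral_theorem, ← map_mul, Unitary.conjStarAlgAut_apply,
        Matrix.trace_mul_comm, ← mul_assoc]
      simp [Matrix.trace, pow_two]
    have h2 : (A * A).trace = ((‖D‖ ^ 2 : ℝ) : ℂ) := by
      rw [EuclideanSpace.norm_sq_eq, Fintype.sum_prod_type, Matrix.trace]
      push_cast
      refine Finset.sum_congr rfl fun i _ => ?_
      rw [Matrix.diag_apply, Matrix.mul_apply]
      refine Finset.sum_congr rfl fun j _ => ?_
      simp only [hAdef, Matrix.of_apply]
      rw [hD.1 i j, ← Complex.mul_conj']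
      rfl
    exact_mod_cast h1.symm.trans h2
  · intro a
    have hsym := Matrix.isSymmetric_toEuclideanLin_iff.2 hA
    set x : EuclideanSpace ℂ (Fin n) := WithLp.toLp 2 a with hx
    have h1 : inner ℝ D (vecRankOne a) = (inner ℂ (A.toEuclideanLin x) x : ℂ).re := by
      simp only [PiLp.inner_apply, Fintype.sum_prod_type, vecRankOne]
      rw [Complex.re_sum]
      refine Finset.sum_congr rfl fun i _ => ?_
      simp only [Complex.inner, hx, Matrix.toLpLin_toLp, RCLike.inner_apply, Matrix.toLin'_apply,
        Matrix.mulVec, dotProduct, hAdef, Matrix.of_apply, map_sum, map_mul, Finset.mul_sum,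
        Complex.re_sum]
      refine Finset.sum_congr rfl fun j _ => ?_
      congr 1
      simp only [Complex.star_def]
      ring
    have h2 (i : Fin n) : hA.eigenvectorBasis.repr (A.toEuclideanLin x) i
        = (hA.eigenvalues i : ℂ) * hA.eigenvectorBasis.repr x i := by
      rw [OrthonormalBasis.repr_apply_apply, OrthonormalBasis.repr_apply_apply,
        ← hsym (hA.eigenvectorBasis i) x]
      have : A.toEuclideanLin (hA.eigenvectorBasis i)
          = (hA.eigenvalues i : ℂ) • hA.eigenvectorBasis i := by
        ext k
        have := congrFun (hA.mulVec_eigenvectorBasis i) k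
        simpa [Matrix.toLpLin_apply] using this
      rw [this, inner_smul_left, Complex.conj_ofReal]
    rw [h1, ← hA.eigenvectorBasis.repr.inner_map_map, PiLp.inner_apply, Complex.re_sum]
    refine Finset.sum_congr rfl fun i _ => ?_
    rw [h2, RCLike.inner_apply, map_mul, Complex.conj_ofReal, mul_left_comm, Complex.mul_conj',
      ← Complex.ofReal_pow, ← Complex.ofReal_mul, Complex.ofReal_re]

/-- In the eigenbasis the form is `∑ l_i |g_i|²` with independent `|g_i|²`. The linear part of the
exponent is then controlled by the trace and the quadratic part by the Frobenius norm; for `τ = 0`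
only `c²` remains. -/
theorem lintegral_exp_inner_vecRankOne_le {n : ℕ} {τ c : ℝ}
    {D : EuclideanSpace ℂ (Fin n × Fin n)} (hD : IsVecHermitian τ D) (hn : ‖D‖ ≤ 1)
    (hc : |c| ≤ 1 / 2) :
    ∫⁻ a, ENNReal.ofReal (Real.exp (c * inner ℝ D (vecRankOne a)))
        ∂(Measure.pi fun _ : Fin n => stdComplexGaussian)
      ≤ ENNReal.ofReal (Real.exp (|c| * τ + c ^ 2)) := by
  obtain ⟨b, l, h1, h2, h3⟩ := exists_diagonalization hD
  have hl (i : Fin n) : |c * l i| ≤ 1 / 2 := by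
    have : l i ^ 2 ≤ 1 := by
      calc l i ^ 2 ≤ ∑ i, l i ^ 2 :=
            Finset.single_le_sum (f := fun i => l i ^ 2) (fun i _ => sq_nonneg _)
              (Finset.mem_univ i)
        _ ≤ 1 := by rw [h2]; exact pow_le_one₀ (norm_nonneg _) hn
    rw [abs_mul]
    calc |c| * |l i| ≤ |c| * 1 := by
          gcongr
          exact (sq_le_one_iff_abs_le_one _).1 this
      _ ≤ 1 / 2 := by linarith
  calc ∫⁻ a, ENNReal.ofReal (Real.exp (c * inner ℝ D (vecRankOne a)))
        ∂(Measure.pi fun _ : Fin n => stdComplexGaussian)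
      = ∫⁻ x : EuclideanSpace ℂ (Fin n), ENNReal.ofReal (Real.exp (∑ i, c * l i * ‖x i‖ ^ 2))
        ∂(((Measure.pi fun _ : Fin n => stdComplexGaussian).map (WithLp.toLp 2)).map b) := by
        rw [lintegral_map (by fun_prop) (by fun_prop), lintegral_map (by fun_prop) (by fun_prop)]
        simp_rw [h3, Finset.mul_sum, mul_assoc]
    _ = ∫⁻ a : Fin n → ℂ, ENNReal.ofReal (Real.exp (∑ i, c * l i * ‖a i‖ ^ 2))
        ∂(Measure.pi fun _ : Fin n => stdComplexGaussian) := by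
        -- The invariance statement concerns real isometries, because characteristic functions use
        -- the real inner product.
        have hb : ⇑b = ⇑(LinearIsometryEquiv.ofSurjective
            (⟨(b : EuclideanSpace ℂ (Fin n) →ₗ[ℂ] EuclideanSpace ℂ (Fin n)).restrictScalars ℝ,
              b.norm_map⟩ : EuclideanSpace ℂ (Fin n) →ₗᵢ[ℝ] EuclideanSpace ℂ (Fin n))
              b.surjective) := rfl
        rw [hb, map_stdComplexGaussian_linearIsometryEquiv, lintegral_map (by fun_prop)
          (by fun_prop)]
    _ ≤ ENNReal.ofReal (Real.exp (∑ i, (c * l i + (c * l i) ^ 2))) :=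
        lintegral_exp_sum_norm_sq_le hl
    _ ≤ _ := by
        gcongr
        rw [Finset.sum_add_distrib, ← Finset.mul_sum]
        simp_rw [mul_pow]
        rw [← Finset.mul_sum, h2]
        gcongr ?_ + ?_
        · calc c * ∑ i, l i ≤ |c * ∑ i, l i| := le_abs_self _
            _ ≤ |c| * τ := by rw [abs_mul]; gcongr
        · nlinarith [sq_nonneg c, pow_le_one₀ (n := 2) (norm_nonneg D) hn]

/-! ### Tail bounds for independent Gaussian vectors -/

/-- The law of `m` independent standard complex Gaussian vectors in `ℂ^n`. -/
noncomputable abbrev gaussianVectors (m n : ℕ) : Measure (Fin m → Fin n → ℂ) :=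
  Measure.pi fun _ : Fin m => Measure.pi fun _ : Fin n => stdComplexGaussian

@[fun_prop]
theorem measurable_vecRankOne {n : ℕ} : Measurable (vecRankOne : (Fin n → ℂ) → _) := by
  unfold vecRankOne
  refine (WithLp.measurable_toLp 2 _).comp (measurable_pi_lambda _ fun p => ?_)
  fun_prop

/-- Bernstein-type bound for the quadratic forms of independent Gaussian vectors, for a Hermitian
matrix that is determined by the remaining vectors. -/
theorem gaussianVectors_le_sum_inner_vecRankOne_le {m n : ℕ} {τ : ℝ} (I : Finset (Fin m))
    {D : (Fin m → Fin n → ℂ) → EuclideanSpace ℂ (Fin n × Fin n)} (hDm : Measurable D)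
    (hD : ∀ x, IsVecHermitian τ (D x)) (hn : ∀ x, ‖D x‖ ≤ 1)
    (hloc : ∀ j ∈ I, ∀ x y, D (Function.update x j y) = D x)
    {c : Fin m → ℝ} (hc : ∀ k ∈ I, |c k| ≤ 1 / 2) (R : ℝ) :
    gaussianVectors m n {x | R ≤ ∑ k ∈ I, c k * inner ℝ (D x) (vecRankOne (x k))}
      ≤ ENNReal.ofReal (Real.exp (∑ k ∈ I, (|c k| * τ + c k ^ 2) - R)) := by
  refine measure_le_sum_le_of_update (Measure.pi fun _ : Fin n => stdComplexGaussian)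
    (fun k x => c k * inner ℝ (D x) (vecRankOne (x k))) (fun k => by fun_prop) _ I ?_ ?_ R
  · intro k _ j hj hjk x y
    simp only [hloc j hj, Function.update_of_ne hjk.symm]
  · intro k hk x
    simp only [hloc k hk, Function.update_self]
    exact lintegral_exp_inner_vecRankOne_le (hD x) (hn x) (hc k hk)

/-- Both signs of `c` are used: positive for the upper tail of `‖a_j‖²`, negative for the lower
tail. -/
theorem gaussianVectors_le_mul_sum_norm_sq_le {m n : ℕ} {c : ℝ} (hc : |c| ≤ 1 / 2) (R : ℝ)
    (j : Fin m) :
    gaussianVectors m n {x | R ≤ c * ∑ i, ‖x j i‖ ^ 2}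
      ≤ ENNReal.ofReal (Real.exp (n * (c + c ^ 2) - R)) := by
  have h := measure_le_sum_le_of_update stdComplexGaussian
    (fun (i : Fin n) (z : Fin n → ℂ) => c * ‖z i‖ ^ 2) (fun k => by fun_prop)
    (fun _ => c + c ^ 2) Finset.univ
    (fun k _ j _ hjk x y => by simp [Function.update_of_ne hjk.symm])
    (fun k _ x => by
      simp only [Function.update_self]
      rw [lintegral_exp_mul_norm_sq_stdComplexGaussian (by linarith [(abs_le.1 hc).2])]
      exact ENNReal.ofReal_le_ofReal (one_div_one_sub_le_exp hc)) R
  simp only [Finset.sum_const, Finset.card_univ, Fintype.card_fin, nsmul_eq_mul] at h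
  have hp := measurePreserving_eval
    (fun _ : Fin m => Measure.pi fun _ : Fin n => stdComplexGaussian) j
  have hs : MeasurableSet {z : Fin n → ℂ | R ≤ ∑ i, c * ‖z i‖ ^ 2} :=
    measurableSet_le measurable_const (by fun_prop)
  rw [← hp.measure_preimage hs.nullMeasurableSet] at h
  simp only [Finset.mul_sum]
  exact h

/-! ### Two deterministic lower bounds for norms of sums -/

section InnerProductSpace

variable {V : Type*} [NormedAddCommGroup V] [InnerProductSpace ℝ V]

/-- Gershgorin's lower bound for the quadratic form of a Gram matrix. -/
theorem mul_sum_sq_le_norm_sum_smul_sq {ι : Type*} [DecidableEq ι] (X : ι → V) (T : Finset ι)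
    (w : ι → ℝ) {q : ℝ} (h : ∀ j ∈ T, q + ∑ k ∈ T.erase j, |inner ℝ (X j) (X k)| ≤ ‖X j‖ ^ 2) :
    q * ∑ j ∈ T, w j ^ 2 ≤ ‖∑ j ∈ T, w j • X j‖ ^ 2 := by
  set g : ι → ι → ℝ := fun j k => if k = j then 0 else |inner ℝ (X j) (X k)| with hg
  have hgs (j k : ι) : g j k = g k j := by
    simp only [hg, eq_comm (a := k) (b := j), real_inner_comm]
  have hrow (j : ι) (hj : j ∈ T) : ∑ k ∈ T, g j k = ∑ k ∈ T.erase j, |inner ℝ (X j) (X k)| := by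
    rw [← Finset.sum_erase T (a := j) (by simp [hg])]
    exact Finset.sum_congr rfl fun k hk => by simp [hg, Finset.ne_of_mem_erase hk]
  -- Off the diagonal, `|w_j w_k| ≤ w_j²/2 + w_k²/2`; keeping the halves separate lets the symmetry
  -- of `g` charge each row with its own off-diagonal sum.
  have hterm (j k : ι) : (if k = j then w j ^ 2 * ‖X j‖ ^ 2 else 0)
      - (w j ^ 2 / 2 * g j k + w k ^ 2 / 2 * g k j) ≤ w j * w k * inner ℝ (X j) (X k) := by
    rw [hgs k j]
    by_cases hjk : k = j
    · subst hjk
      simp only [hg, if_true, real_inner_self_eq_norm_sq]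
      nlinarith
    · simp only [hg, if_neg hjk]
      have h1 := neg_abs_le (w j * w k * inner ℝ (X j) (X k))
      rw [abs_mul, abs_mul] at h1
      have h2 : |w j| * |w k| ≤ w j ^ 2 / 2 + w k ^ 2 / 2 := by
        rw [← sq_abs (w j), ← sq_abs (w k)]
        nlinarith [sq_nonneg (|w j| - |w k|)]
      nlinarith [mul_le_mul_of_nonneg_right h2 (abs_nonneg (inner ℝ (X j) (X k)))]
  have hexp : ‖∑ j ∈ T, w j • X j‖ ^ 2
      = ∑ j ∈ T, ∑ k ∈ T, w j * w k * inner ℝ (X j) (X k) := by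
    rw [← real_inner_self_eq_norm_sq, sum_inner]
    refine Finset.sum_congr rfl fun j _ => ?_
    rw [inner_sum]
    refine Finset.sum_congr rfl fun k _ => ?_
    rw [real_inner_smul_left, real_inner_smul_right, mul_assoc]
  rw [hexp]
  refine le_trans ?_ (Finset.sum_le_sum fun j _ => Finset.sum_le_sum fun k _ => hterm j k)
  simp_rw [Finset.sum_sub_distrib, Finset.sum_add_distrib, Finset.sum_ite_eq']
  rw [Finset.sum_comm (f := fun j k => w k ^ 2 / 2 * g k j), ← two_mul, Finset.mul_sum,
    Finset.mul_sum, ← Finset.sum_sub_distrib]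
  refine Finset.sum_le_sum fun j hj => ?_
  rw [if_pos hj, ← Finset.mul_sum, hrow j hj]
  nlinarith [mul_le_mul_of_nonneg_left (h j hj) (sq_nonneg (w j))]

/-- If consecutive blocks are almost orthogonal to the preceding partial sums, then the squared norm
of the whole sum is controlled from below by the squared norms of the blocks. -/
theorem half_sum_sub_le_norm_sq {S B : ℕ → V} {q : ℕ → ℝ} {e : ℝ} {b : ℕ} (hb : 0 < b)
    (h0 : S 0 = B 0) (hS : ∀ k, S (k + 1) = S k + B (k + 1)) (hq0 : ∀ k, 0 ≤ q k)
    (hq : ∀ k ≤ b, q k ≤ ‖B k‖ ^ 2) (hc : ∀ k < b, -(e * ‖S k‖) ≤ inner ℝ (S k) (B (k + 1))) :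
    (∑ k ∈ Finset.range (b + 1), q k) / 2 - 2 * b ^ 2 * e ^ 2 ≤ ‖S b‖ ^ 2 := by
  have hb' : (1 : ℝ) ≤ b := by exact_mod_cast hb
  -- Each step may lose the fraction `1/(2b)` of the squared norm; after `b` steps at least half is
  -- left, by Bernoulli's inequality.
  set r : ℝ := 1 - 1 / (2 * b) with hr
  have hr0 : 0 ≤ r := by
    rw [hr, sub_nonneg, div_le_one (by linarith)]
    linarith
  have hr1 : r ≤ 1 := by
    rw [hr, sub_le_self_iff]
    positivity
  have key : ∀ k ≤ b, r ^ k * ∑ i ∈ Finset.range (k + 1), q i - k * (2 * b * e ^ 2)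
      ≤ ‖S k‖ ^ 2 := by
    intro k
    induction k with
    | zero => intro _; simpa [h0] using hq 0 (Nat.zero_le _)
    | succ k ih =>
      intro hk
      have h1 := ih (by omega)
      have h2 := hq (k + 1) hk
      have h3 := hc k (by omega)
      have h4 : ‖S (k + 1)‖ ^ 2 = ‖S k‖ ^ 2 + 2 * inner ℝ (S k) (B (k + 1)) + ‖B (k + 1)‖ ^ 2 := by
        rw [hS, norm_add_sq_real]
      have h5 : 2 * (e * ‖S k‖) ≤ 1 / (2 * b) * ‖S k‖ ^ 2 + 2 * b * e ^ 2 := by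
        have : 1 / (2 * b) * ‖S k‖ ^ 2 + 2 * b * e ^ 2 - 2 * (e * ‖S k‖)
            = 1 / (2 * b) * (‖S k‖ - 2 * b * e) ^ 2 := by
          field_simp
          ring
        have h6 : 0 ≤ 1 / (2 * (b : ℝ)) * (‖S k‖ - 2 * b * e) ^ 2 := by positivity
        linarith
      have h6 : r * ‖S k‖ ^ 2 + q (k + 1) - 2 * b * e ^ 2 ≤ ‖S (k + 1)‖ ^ 2 := by
        rw [h4, hr]
        linarith
      have h7 := mul_le_mul_of_nonneg_left h1 hr0
      have h8 : r ^ (k + 1) * q (k + 1) ≤ q (k + 1) :=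
        mul_le_of_le_one_left (hq0 _) (pow_le_one₀ hr0 hr1)
      have h9 : r * (k * (2 * b * e ^ 2)) ≤ k * (2 * b * e ^ 2) :=
        mul_le_of_le_one_left (by positivity) hr1
      rw [Finset.sum_range_succ, mul_add, pow_succ']
      push_cast
      rw [pow_succ'] at h8
      linarith
  have hrb : 1 / 2 ≤ r ^ b := by
    have := one_add_mul_le_pow (a := -(1 / (2 * (b : ℝ)))) (by
      have : 1 / (2 * (b : ℝ)) ≤ 1 := by rw [div_le_one (by linarith)]; linarith
      linarith) b
    have h2 : 1 + (b : ℝ) * -(1 / (2 * b)) = 1 / 2 := by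
      field_simp
      ring
    rw [h2] at this
    simpa [hr, sub_eq_add_neg] using this
  have h1 := key b le_rfl
  have h2 := mul_le_mul_of_nonneg_right hrb
    (Finset.sum_nonneg fun i (_ : i ∈ Finset.range (b + 1)) => hq0 i)
  linarith

end InnerProductSpace

/-! ### Traceless parts of rank-one matrices -/

section Traceless

variable {n : ℕ}

/-- The vectorization of the identity matrix. -/
noncomputable def vecOne (n : ℕ) : EuclideanSpace ℂ (Fin n × Fin n) :=
  WithLp.toLp 2 fun p => if p.1 = p.2 then 1 else 0

/-- The vectorization of the traceless part of `a a*`. -/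
noncomputable def vecTraceless (a : Fin n → ℂ) : EuclideanSpace ℂ (Fin n × Fin n) :=
  vecRankOne a - ((∑ i, ‖a i‖ ^ 2) / n) • vecOne n

theorem inner_vecOne (D : EuclideanSpace ℂ (Fin n × Fin n)) :
    inner ℝ D (vecOne n) = ∑ i, (D (i, i)).re := by
  simp only [PiLp.inner_apply, Fintype.sum_prod_type, vecOne]
  refine Finset.sum_congr rfl fun i _ => ?_
  rw [Finset.sum_eq_single i]
  · simp [Complex.inner]
  · intro j _ hj
    simp [Ne.symm hj]
  · simp

theorem inner_vecRankOne (a b : Fin n → ℂ) :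
    inner ℝ (vecRankOne a) (vecRankOne b) = ‖∑ i, star (a i) * b i‖ ^ 2 := by
  have h : ((‖∑ i, star (a i) * b i‖ ^ 2 : ℝ) : ℂ)
      = ∑ i, ∑ j, (star (a i) * b i) * star (star (a j) * b j) := by
    push_cast
    rw [← Complex.mul_conj', map_sum, Finset.sum_mul_sum]
    rfl
  have h2 := congrArg Complex.re h
  rw [Complex.ofReal_re, Complex.re_sum] at h2
  rw [h2]
  simp only [PiLp.inner_apply, Fintype.sum_prod_type, vecRankOne]
  refine Finset.sum_congr rfl fun i _ => ?_
  rw [Complex.re_sum]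
  refine Finset.sum_congr rfl fun j _ => ?_
  rw [Complex.inner]
  congr 1
  simp only [Complex.star_def, map_mul, Complex.conj_conj]
  ring

theorem sum_re_vecRankOne (a : Fin n → ℂ) :
    ∑ i, (vecRankOne a (i, i)).re = ∑ i, ‖a i‖ ^ 2 := by
  refine Finset.sum_congr rfl fun i _ => ?_
  simp only [vecRankOne, Complex.star_def, Complex.mul_conj']
  rw [← Complex.ofReal_pow, Complex.ofReal_re]

theorem norm_vecRankOne (a : Fin n → ℂ) : ‖vecRankOne a‖ = ∑ i, ‖a i‖ ^ 2 := by
  rw [← sq_eq_sq₀ (norm_nonneg _) (by positivity), ← real_inner_self_eq_norm_sq, inner_vecRankOne]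
  have : ∑ i, star (a i) * a i = ((∑ i, ‖a i‖ ^ 2 : ℝ) : ℂ) := by
    push_cast
    exact Finset.sum_congr rfl fun i _ => by rw [Complex.star_def, Complex.conj_mul']
  rw [this, Complex.norm_real, Real.norm_eq_abs, sq_abs]

theorem inner_vecTraceless (a b : Fin n → ℂ) (hn : n ≠ 0) :
    inner ℝ (vecTraceless a) (vecTraceless b)
      = ‖∑ i, star (a i) * b i‖ ^ 2 - (∑ i, ‖a i‖ ^ 2) * (∑ i, ‖b i‖ ^ 2) / n := by
  have hn' : (n : ℝ) ≠ 0 := by exact_mod_cast hn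
  have h1 : inner ℝ (vecOne n) (vecOne n) = (n : ℝ) := by
    rw [inner_vecOne]
    simp [vecOne]
  simp only [vecTraceless, inner_sub_left, inner_sub_right, real_inner_smul_left,
    real_inner_smul_right, h1, inner_vecRankOne, inner_vecOne, sum_re_vecRankOne,
    real_inner_comm (vecRankOne b) (vecOne n)]
  field_simp
  ring

theorem isVecHermitian_vecRankOne (a : Fin n → ℂ) :
    IsVecHermitian (∑ i, ‖a i‖ ^ 2) (vecRankOne a) := by
  refine ⟨fun i j => ?_, ?_⟩
  · simp [vecRankOne, mul_comm]
  · rw [sum_re_vecRankOne, abs_of_nonneg (by positivity)]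

theorem IsVecHermitian.smul {τ : ℝ} {D : EuclideanSpace ℂ (Fin n × Fin n)}
    (hD : IsVecHermitian τ D) (c : ℝ) : IsVecHermitian (|c| * τ) (c • D) := by
  refine ⟨fun i j => ?_, ?_⟩
  · simp [hD.1 i j]
  · have : ∑ i, ((c • D) (i, i)).re = c * ∑ i, (D (i, i)).re := by
      rw [Finset.mul_sum]
      simp
    rw [this, abs_mul]
    exact mul_le_mul_of_nonneg_left hD.2 (abs_nonneg c)

theorem isVecHermitian_vecTraceless (a : Fin n → ℂ) : IsVecHermitian 0 (vecTraceless a) := by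
  refine ⟨fun i j => ?_, ?_⟩
  · by_cases h : i = j
    · simp [vecTraceless, vecRankOne, vecOne, h, mul_comm]
    · simp [vecTraceless, vecRankOne, vecOne, h, Ne.symm h, mul_comm]
  · rcases Nat.eq_zero_or_pos n with rfl | hn
    · simp
    have hn' : (n : ℝ) ≠ 0 := by positivity
    rw [← inner_vecOne, vecTraceless, inner_sub_left, real_inner_smul_left, inner_vecOne,
      inner_vecOne, sum_re_vecRankOne]
    simp [vecOne, hn']

theorem isVecHermitian_sum_smul {ι : Type*} (T : Finset ι) (w : ι → ℝ)
    {D : ι → EuclideanSpace ℂ (Fin n × Fin n)} (hD : ∀ i ∈ T, IsVecHermitian 0 (D i)) :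
    IsVecHermitian 0 (∑ i ∈ T, w i • D i) := by
  refine ⟨fun i j => ?_, ?_⟩
  · simp only [WithLp.ofLp_sum, WithLp.ofLp_smul, Finset.sum_apply, Pi.smul_apply, star_sum]
    refine Finset.sum_congr rfl fun k hk => ?_
    simp [(hD k hk).1 i j]
  · rw [← inner_vecOne, sum_inner]
    refine le_of_eq (abs_eq_zero.2 (Finset.sum_eq_zero fun k hk => ?_))
    have := (hD k hk).2
    rw [real_inner_smul_left, inner_vecOne, abs_nonpos_iff.1 this, mul_zero]

/-- A traceless matrix is orthogonal to the identity. Hence the tail bounds for `a a*` apply to its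
traceless part. -/
theorem IsVecHermitian.inner_vecTraceless {D : EuclideanSpace ℂ (Fin n × Fin n)}
    (hD : IsVecHermitian 0 D) (a : Fin n → ℂ) :
    inner ℝ D (vecTraceless a) = inner ℝ D (vecRankOne a) := by
  rw [vecTraceless, inner_sub_right, real_inner_smul_right, inner_vecOne,
    abs_nonpos_iff.1 hD.2, mul_zero, sub_zero]

end Traceless

/-! ### Trace norm bound and reduction to the Gram matrix -/

theorem schattenNorm_one {n : ℕ} (X : Matrix (Fin n) (Fin n) ℂ) :
    schattenNorm 1 X = ∑ i : Fin n, X.toEuclideanLin.singularValues i := by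
  rw [schattenNorm, PiLp.norm_eq_of_L1]
  refine Finset.sum_congr rfl fun i _ => ?_
  rw [Real.norm_eq_abs]
  exact abs_of_nonneg (LinearMap.singularValues_nonneg _ _)

/-- The sum of the singular values of `∑ v_j a_j a_j*` is at most `∑ |v_j| ‖a_j‖²`. -/
theorem sum_singularValues_le {E : Type*} [NormedAddCommGroup E] [InnerProductSpace ℂ E]
    [FiniteDimensional ℂ E] {n : ℕ} (hn : Module.finrank ℂ E = n) {ι : Type*} (s : Finset ι)
    (v : ι → ℝ) (a : ι → E) (T : E →ₗ[ℂ] E)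
    (hT : ∀ x, T x = ∑ j ∈ s, (v j : ℂ) • (inner ℂ (a j) x • a j)) :
    ∑ i : Fin n, T.singularValues i ≤ ∑ j ∈ s, |v j| * ‖a j‖ ^ 2 := by
  -- `f` consists of right singular vectors.
  set f := T.isSymmetric_adjoint_comp_self.eigenvectorBasis hn with hf
  set σ : Fin n → ℝ := fun i => T.singularValues i with hσ
  have hinner (i k : Fin n) : inner ℂ (T (f i)) (T (f k)) = if i = k then ((σ k : ℂ)) ^ 2 else 0 := by
    rw [← LinearMap.adjoint_inner_right]
    have h := T.isSymmetric_adjoint_comp_self.apply_eigenvectorBasis hn k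
    rw [LinearMap.comp_apply, ← T.sq_singularValues_fin hn] at h
    rw [hf, h, inner_smul_right, orthonormal_iff_ite.1
      (T.isSymmetric_adjoint_comp_self.eigenvectorBasis hn).orthonormal i k]
    split_ifs <;> simp [hσ]
  -- These are left singular vectors. Since `0⁻¹ = 0`, `g i` vanishes when `σ i = 0`, so Bessel's
  -- inequality holds for the whole family and `σ i = ⟨g i, T (f i)⟩` for every `i`.
  set g : Fin n → E := fun i => ((σ i)⁻¹ : ℂ) • T (f i) with hg
  have hgo : Orthonormal ℂ (fun i : {i // σ i ≠ 0} => g i) := by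
    rw [orthonormal_iff_ite]
    rintro ⟨i, hi⟩ ⟨k, hk⟩
    simp only [hg, inner_smul_left, inner_smul_right, hinner, Subtype.mk.injEq]
    split_ifs with h
    · subst h
      have : (σ i : ℂ) ≠ 0 := by exact_mod_cast hi
      rw [map_inv₀, Complex.conj_ofReal]
      field_simp
    · simp
  have hbessel (x : E) : ∑ i, ‖inner ℂ (g i) x‖ ^ 2 ≤ ‖x‖ ^ 2 := by
    have h := hgo.sum_inner_products_le x (s := Finset.univ)
    refine le_trans (le_of_eq ?_) h
    rw [← Finset.sum_filter_of_ne (p := fun i => σ i ≠ 0),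
      Finset.sum_subtype (p := fun i => σ i ≠ 0) (Finset.univ.filter fun i => σ i ≠ 0) (by simp)]
    intro i _ hi h
    simp [hg, h] at hi
  have hpars (x : E) : ∑ i, ‖inner ℂ x (f i)‖ ^ 2 = ‖x‖ ^ 2 := f.sum_sq_norm_inner_left x
  have hσg (i : Fin n) : σ i = (inner ℂ (g i) (T (f i)) : ℂ).re := by
    simp only [hg, inner_smul_left, hinner, if_true]
    rw [map_inv₀, Complex.conj_ofReal]
    by_cases h : σ i = 0
    · simp [h]
    · have : (σ i : ℂ) ≠ 0 := by exact_mod_cast h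
      rw [pow_two, inv_mul_cancel_left₀ this, Complex.ofReal_re]
  calc ∑ i, σ i = ∑ i, ∑ j ∈ s, v j * (inner ℂ (a j) (f i) * inner ℂ (g i) (a j) : ℂ).re := by
        refine Finset.sum_congr rfl fun i _ => ?_
        rw [hσg, hT, inner_sum, Complex.re_sum]
        refine Finset.sum_congr rfl fun j _ => ?_
        rw [inner_smul_right, inner_smul_right, Complex.re_ofReal_mul]
    _ ≤ ∑ i, ∑ j ∈ s, |v j| * ((‖inner ℂ (a j) (f i)‖ ^ 2 + ‖inner ℂ (g i) (a j)‖ ^ 2) / 2) := by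
        refine Finset.sum_le_sum fun i _ => Finset.sum_le_sum fun j _ => ?_
        refine (le_abs_self _).trans ?_
        rw [abs_mul]
        gcongr
        refine (Complex.abs_re_le_norm _).trans ?_
        rw [norm_mul]
        nlinarith [sq_nonneg (‖inner ℂ (a j) (f i)‖ - ‖inner ℂ (g i) (a j)‖)]
    _ = ∑ j ∈ s, |v j| * ((∑ i, ‖inner ℂ (a j) (f i)‖ ^ 2
          + ∑ i, ‖inner ℂ (g i) (a j)‖ ^ 2) / 2) := by
        rw [Finset.sum_comm]
        refine Finset.sum_congr rfl fun j _ => ?_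
        rw [← Finset.mul_sum, ← Finset.sum_div, Finset.sum_add_distrib]
    _ ≤ ∑ j ∈ s, |v j| * ‖a j‖ ^ 2 := by
        gcongr with j _
        rw [hpars]
        linarith [hbessel (a j)]

theorem schattenNorm_one_sum_smul_rankOne_le {n : ℕ} {ι : Type*} (s : Finset ι) (v : ι → ℝ)
    (a : ι → Fin n → ℂ) :
    schattenNorm 1 (∑ j ∈ s, v j • rankOne (a j)) ≤ ∑ j ∈ s, |v j| * ∑ i, ‖a j i‖ ^ 2 := by
  rw [schattenNorm_one]
  refine (sum_singularValues_le finrank_euclideanSpace_fin s v (fun j => WithLp.toLp 2 (a j)) _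
    fun x => ?_).trans (le_of_eq ?_)
  · ext i
    simp only [Matrix.toLpLin_apply, Matrix.sum_mulVec, WithLp.ofLp_sum, Finset.sum_apply]
    refine Finset.sum_congr rfl fun j _ => ?_
    simp [rankOne, Matrix.smul_mulVec, Matrix.vecMulVec_mulVec, PiLp.inner_apply, dotProduct, mul_comm]
  · simp only [EuclideanSpace.norm_sq_eq]

theorem isHermitian_rankOne {n : ℕ} (v : Fin n → ℂ) : IsSelfAdjoint (rankOne v) := by
  simp [rankOne, IsSelfAdjoint, Matrix.star_eq_conjTranspose, Matrix.conjTranspose_vecMulVec]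

theorem frobeniusInner_rankOne_re {n : ℕ} (v u : Fin n → ℂ) :
    (frobeniusInner (rankOne v) (rankOne u)).re = ‖∑ i, star (v i) * u i‖ ^ 2 := by
  have h : (rankOne u).conjTranspose = rankOne u := isHermitian_rankOne u
  have h2 : (star v ⬝ᵥ u) * (v ⬝ᵥ star u) = ((‖∑ i, star (v i) * u i‖ ^ 2 : ℝ) : ℂ) := by
    push_cast
    rw [← Complex.mul_conj', map_sum]
    simp [dotProduct]
  rw [frobeniusInner, h, rankOne, rankOne, Matrix.vecMulVec_mul_vecMulVec, Matrix.trace_vecMulVec,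
    dotProduct_smul, smul_eq_mul, h2, Complex.ofReal_re]

/-- The Hermitian matrix `∑ v_j a_j a_j*`. -/
noncomputable def adjointMeasurement {m n : ℕ} (a : Fin m → Fin n → ℂ) :
    EuclideanSpace ℝ (Fin m) →ₗ[ℝ] HermitianMatrix n where
  toFun v := ∑ j, v j • ⟨rankOne (a j), isHermitian_rankOne (a j)⟩
  map_add' v w := by simp [add_smul, Finset.sum_add_distrib]
  map_smul' c v := by simp [mul_smul, Finset.smul_sum]

theorem coe_adjointMeasurement {m n : ℕ} (a : Fin m → Fin n → ℂ) (v : EuclideanSpace ℝ (Fin m)) :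
    (adjointMeasurement a v : Matrix (Fin n) (Fin n) ℂ) = ∑ j, v j • rankOne (a j) := by
  simp [adjointMeasurement]

theorem measurementOperator_adjointMeasurement_apply {m n : ℕ} (a : Fin m → Fin n → ℂ)
    (v : EuclideanSpace ℝ (Fin m)) (k : Fin m) :
    measurementOperator a (adjointMeasurement a v) k
      = ∑ j, v j * ‖∑ i, star (a k i) * a j i‖ ^ 2 := by
  have h : measurementOperator a (adjointMeasurement a v)
      = ∑ j, v j • measurementOperator a ⟨rankOne (a j), isHermitian_rankOne (a j)⟩ := by
    simp [adjointMeasurement]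
  rw [h, WithLp.ofLp_sum, Finset.sum_apply]
  refine Finset.sum_congr rfl fun j _ => ?_
  rw [← frobeniusInner_rankOne_re]
  simp [measurementOperator]

/-- Removing the identity components lowers the quadratic form by exactly `(∑ v_j ‖a_j‖²)² / n`. -/
theorem norm_sum_smul_vecTraceless_sq_le {m n : ℕ} (hn : n ≠ 0) (a : Fin m → Fin n → ℂ)
    (v : EuclideanSpace ℝ (Fin m)) :
    ‖∑ j, v j • vecTraceless (a j)‖ ^ 2
      ≤ inner ℝ v (measurementOperator a (adjointMeasurement a v)) := by
  have h1 : inner ℝ v (measurementOperator a (adjointMeasurement a v))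
      = ∑ k, ∑ j, v k * v j * ‖∑ i, star (a k i) * a j i‖ ^ 2 := by
    simp only [PiLp.inner_apply, measurementOperator_adjointMeasurement_apply,
      RCLike.inner_apply, conj_trivial]
    refine Finset.sum_congr rfl fun k _ => ?_
    rw [Finset.sum_mul]
    exact Finset.sum_congr rfl fun j _ => by ring
  have h2 : ‖∑ j, v j • vecTraceless (a j)‖ ^ 2
      = ∑ k, ∑ j, v k * v j * ‖∑ i, star (a k i) * a j i‖ ^ 2
        - (∑ j, v j * ∑ i, ‖a j i‖ ^ 2) ^ 2 / n := by
    rw [← real_inner_self_eq_norm_sq, sum_inner, pow_two (∑ j, v j * ∑ i, ‖a j i‖ ^ 2),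
      Finset.sum_mul_sum, Finset.sum_div, ← Finset.sum_sub_distrib]
    refine Finset.sum_congr rfl fun k _ => ?_
    rw [inner_sum, Finset.sum_div, ← Finset.sum_sub_distrib]
    refine Finset.sum_congr rfl fun j _ => ?_
    rw [real_inner_smul_left, real_inner_smul_right, inner_vecTraceless _ _ hn]
    ring
  rw [h1, h2, sub_le_self_iff]
  positivity

/-- The lower bound makes `𝒜𝒜*` invertible with inverse of norm at most `36/n²`. The witness is `U =
𝒜* v` with `𝒜𝒜* v = w`, and Cauchy–Schwarz on `∑ |v_j|` gives the factor `√m`. -/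
theorem exists_measurement_eq {m n : ℕ} (hn : 0 < n) (a : Fin m → Fin n → ℂ)
    (hub : ∀ j, ∑ i, ‖a j i‖ ^ 2 ≤ 2 * n)
    (hlow : ∀ v : EuclideanSpace ℝ (Fin m),
      (n : ℝ) ^ 2 / 36 * ‖v‖ ^ 2 ≤ ‖∑ j, v j • vecTraceless (a j)‖ ^ 2)
    (w : EuclideanSpace ℝ (Fin m)) :
    ∃ U : HermitianMatrix n, measurementOperator a U = w ∧
      schattenNorm 1 (U : Matrix (Fin n) (Fin n) ℂ) ≤ 72 * Real.sqrt m / n * ‖w‖ := by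
  have hn' : (0 : ℝ) < n := by exact_mod_cast hn
  have hlow' (v : EuclideanSpace ℝ (Fin m)) : (n : ℝ) ^ 2 / 36 * ‖v‖ ^ 2
      ≤ inner ℝ v (measurementOperator a (adjointMeasurement a v)) :=
    (hlow v).trans (norm_sum_smul_vecTraceless_sq_le hn.ne' a v)
  have hinj : Function.Injective (measurementOperator a ∘ₗ adjointMeasurement a) := by
    rw [← LinearMap.ker_eq_bot, LinearMap.ker_eq_bot']
    intro v hv
    have h := hlow' v
    rw [LinearMap.comp_apply] at hv
    rw [hv, inner_zero_right] at h
    have h2 : ‖v‖ ^ 2 ≤ 0 := by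
      by_contra hc
      push Not at hc
      have : 0 < (n : ℝ) ^ 2 / 36 * ‖v‖ ^ 2 := by positivity
      linarith
    simpa using le_antisymm h2 (sq_nonneg _)
  obtain ⟨v, hv⟩ := LinearMap.injective_iff_surjective.1 hinj w
  rw [LinearMap.comp_apply] at hv
  refine ⟨adjointMeasurement a v, hv, ?_⟩
  have h1 : (n : ℝ) ^ 2 / 36 * ‖v‖ ≤ ‖w‖ := by
    have h := (hlow' v).trans (real_inner_le_norm _ _)
    rw [hv] at h
    rcases eq_or_lt_of_le (norm_nonneg v) with h0 | h0
    · rw [← h0]; simp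
    · refine le_of_mul_le_mul_right ?_ h0
      linarith
  have h2 : ∑ j, |v j| ≤ Real.sqrt m * ‖v‖ := by
    have h := Real.sum_mul_le_sqrt_mul_sqrt Finset.univ (fun _ : Fin m => (1 : ℝ)) fun j => |v j|
    simpa [EuclideanSpace.norm_eq] using h
  rw [coe_adjointMeasurement]
  calc schattenNorm 1 (∑ j, v j • rankOne (a j))
      ≤ ∑ j, |v j| * ∑ i, ‖a j i‖ ^ 2 := schattenNorm_one_sum_smul_rankOne_le _ _ _
    _ ≤ ∑ j, |v j| * (2 * n) := by gcongr with j; exact hub j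
    _ = (2 * n) * ∑ j, |v j| := by rw [← Finset.sum_mul, mul_comm]
    _ ≤ (2 * n) * (Real.sqrt m * ‖v‖) := by gcongr
    _ = 72 * Real.sqrt m / n * ((n : ℝ) ^ 2 / 36 * ‖v‖) := by field_simp; ring
    _ ≤ _ := by gcongr

/-- The product `d r^{1/2}` equals `128√2 · m/n`, free of `κ`. One event therefore serves all `κ`,
and `72 ≤ 128√2` finishes. -/
theorem hasQuotientProperty_measurementOperator {m n : ℕ} (hm : 0 < m) (hn : 0 < n)
    (a : Fin m → Fin n → ℂ) (hub : ∀ j, ∑ i, ‖a j i‖ ^ 2 ≤ 2 * n)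
    (hlow : ∀ v : EuclideanSpace ℝ (Fin m),
      (n : ℝ) ^ 2 / 36 * ‖v‖ ^ 2 ≤ ‖∑ j, v j • vecTraceless (a j)‖ ^ 2)
    {κ : ℝ} (hκ : 0 < κ) :
    HasQuotientProperty 1 (128 * Real.sqrt 2 / κ * Real.sqrt (κ * (m : ℝ) / (n : ℝ)))
      (κ * (m : ℝ) / (n : ℝ)) ((1 / Real.sqrt (m : ℝ)) • measurementOperator a) := by
  have hm' : (0 : ℝ) < m := by exact_mod_cast hm
  have hn' : (0 : ℝ) < n := by exact_mod_cast hn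
  have hs : 0 < Real.sqrt m := Real.sqrt_pos.2 hm'
  intro w
  obtain ⟨U, hU, hb⟩ := exists_measurement_eq hn a hub hlow (Real.sqrt m • w)
  refine ⟨U, ?_, hb.trans ?_⟩
  · rw [LinearMap.smul_apply, hU, smul_smul, one_div, inv_mul_cancel₀ hs.ne', one_smul]
  · have hexp : ((1 : ℝ≥0∞).toReal⁻¹ - 1 / 2 : ℝ) = 1 / 2 := by norm_num
    rw [hexp, ← Real.sqrt_eq_rpow, mul_assoc (128 * Real.sqrt 2 / κ),
      Real.mul_self_sqrt (by positivity), norm_smul, Real.norm_eq_abs, abs_of_pos hs,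
      ← mul_assoc]
    gcongr ?_ * _
    have h1 : 72 * Real.sqrt m / n * Real.sqrt m = 72 * (m / n) := by
      rw [mul_comm, ← mul_div_assoc, mul_left_comm, Real.mul_self_sqrt hm'.le, mul_div_assoc]
    have h2 : 128 * Real.sqrt 2 / κ * (κ * m / n) = 128 * Real.sqrt 2 * (m / n) := by
      field_simp
    rw [h1, h2]
    have h3 : 1 ≤ Real.sqrt 2 := Real.one_le_sqrt.2 (by norm_num)
    gcongr
    linarith

/-! ### Well-spread vectors and the block decomposition -/

theorem norm_vecTraceless_sq {n : ℕ} (hn : n ≠ 0) (a : Fin n → ℂ) :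
    ‖vecTraceless a‖ ^ 2 = (∑ i, ‖a i‖ ^ 2) ^ 2 - (∑ i, ‖a i‖ ^ 2) ^ 2 / n := by
  rw [← real_inner_self_eq_norm_sq, inner_vecTraceless _ _ hn, ← inner_vecRankOne,
    real_inner_self_eq_norm_sq, norm_vecRankOne]
  ring

theorem norm_vecTraceless_le {n : ℕ} (hn : n ≠ 0) (a : Fin n → ℂ) :
    ‖vecTraceless a‖ ≤ ∑ i, ‖a i‖ ^ 2 := by
  refine le_of_sq_le_sq ?_ (by positivity)
  rw [norm_vecTraceless_sq hn, sub_le_self_iff]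
  positivity

/-- The squared norms of the vectors are of order `n`, and no vector is strongly correlated with a
small set of the others. -/
structure IsWellSpread {m n : ℕ} (s : ℕ) (a : Fin m → Fin n → ℂ) : Prop where
  le_norm_sq : ∀ j, (n : ℝ) / 2 ≤ ∑ i, ‖a j i‖ ^ 2
  norm_sq_le : ∀ j, ∑ i, ‖a j i‖ ^ 2 ≤ 2 * n
  sum_inner_le : ∀ j, ∀ T : Finset (Fin m), j ∉ T → T.card ≤ s →
    ∑ k ∈ T, inner ℝ ((∑ i, ‖a j i‖ ^ 2)⁻¹ • vecRankOne (a j)) (vecRankOne (a k)) ≤ n / 20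

/-- Gershgorin's bound. With `r = ‖a_j‖²`, the trace corrections cost at most `2(s+1) r ≤ rn/20` and
the correlations another `rn/20`, leaving `r(r - n/10) ≥ n²/5` since `r ≥ n/2`. -/
theorem IsWellSpread.mul_sum_sq_le {m n s : ℕ} {a : Fin m → Fin n → ℂ} (ha : IsWellSpread s a)
    (hs : 40 * (s + 1) ≤ n) (T : Finset (Fin m)) (hT : T.card ≤ s) (w : Fin m → ℝ) :
    (n : ℝ) ^ 2 / 5 * ∑ j ∈ T, w j ^ 2 ≤ ‖∑ j ∈ T, w j • vecTraceless (a j)‖ ^ 2 := by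
  have hn : n ≠ 0 := by omega
  have hn' : (0 : ℝ) < n := by positivity
  have hs' : 40 * ((s : ℝ) + 1) ≤ n := by exact_mod_cast hs
  refine mul_sum_sq_le_norm_sum_smul_sq _ T w fun j hj => ?_
  set r : Fin m → ℝ := fun j => ∑ i, ‖a j i‖ ^ 2 with hr
  have h1 : (n : ℝ) / 2 ≤ r j := ha.le_norm_sq j
  have hrj : 0 < r j := by linarith
  have hcard : (T.erase j).card ≤ s := (Finset.card_erase_le).trans hT
  have h3 : ∑ k ∈ T.erase j, inner ℝ (vecRankOne (a j)) (vecRankOne (a k)) ≤ r j * (n / 20) := by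
    have h := ha.sum_inner_le j (T.erase j) (Finset.notMem_erase j T) hcard
    simp_rw [real_inner_smul_left] at h
    rw [← Finset.mul_sum, inv_mul_le_iff₀ hrj] at h
    exact h
  have h4 : ∑ k ∈ T.erase j, |inner ℝ (vecTraceless (a j)) (vecTraceless (a k))|
      ≤ r j * (n / 20) + s * (2 * r j) := by
    calc _ ≤ ∑ k ∈ T.erase j, (inner ℝ (vecRankOne (a j)) (vecRankOne (a k)) + 2 * r j) := by
          refine Finset.sum_le_sum fun k _ => ?_
          rw [inner_vecTraceless _ _ hn, ← inner_vecRankOne]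
          refine (abs_sub _ _).trans ?_
          have h5 : 0 ≤ inner ℝ (vecRankOne (a j)) (vecRankOne (a k)) := by
            rw [inner_vecRankOne]
            positivity
          rw [abs_of_nonneg h5, abs_of_nonneg (by positivity)]
          gcongr
          rw [div_le_iff₀ hn']
          have := mul_le_mul_of_nonneg_left (ha.norm_sq_le k) hrj.le
          linarith
      _ ≤ _ := by
          rw [Finset.sum_add_distrib, Finset.sum_const, nsmul_eq_mul]
          have : ((T.erase j).card : ℝ) ≤ s := by exact_mod_cast hcard
          gcongr
  have h5 : r j ^ 2 / n ≤ 2 * r j := by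
    rw [div_le_iff₀ hn']
    have := mul_le_mul_of_nonneg_left (ha.norm_sq_le j) hrj.le
    nlinarith
  rw [norm_vecTraceless_sq hn]
  change _ ≤ r j ^ 2 - r j ^ 2 / n
  nlinarith [mul_le_mul_of_nonneg_left h1 hrj.le, mul_le_mul_of_nonneg_left h1 hn'.le,
    mul_le_mul_of_nonneg_left hs' hrj.le]

/-- The block of a coordinate: the large coordinates form block `0`, the others are cut into
intervals of length `s`. -/
noncomputable def blockLabel {m : ℕ} (s : ℕ) (w : Fin m → ℝ) (j : Fin m) : ℕ :=
  if 1 < s * w j ^ 2 then 0 else j / s + 1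

theorem blockLabel_le {m : ℕ} (s : ℕ) (w : Fin m → ℝ) (j : Fin m) :
    blockLabel s w j ≤ m / s + 1 := by
  rw [blockLabel]
  split_ifs
  · exact Nat.zero_le _
  · exact Nat.succ_le_succ (Nat.div_le_div_right j.2.le)

/-- At most `s` coordinates can satisfy `w_j² > 1/s` when `∑ w_j² ≤ 1`; every other block lies in an
interval of length `s`. -/
theorem card_blockLabel_eq_le {m s : ℕ} (hs : 0 < s) {w : Fin m → ℝ} (hw : ∑ j, w j ^ 2 ≤ 1)
    (k : ℕ) : (Finset.univ.filter fun j => blockLabel s w j = k).card ≤ s := by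
  have hs' : (0 : ℝ) < s := by exact_mod_cast hs
  rcases k with _ | k
  · have h1 : ((Finset.univ.filter fun j => blockLabel s w j = 0).card : ℝ)
        ≤ ∑ j ∈ Finset.univ.filter fun j => blockLabel s w j = 0, s * w j ^ 2 := by
      rw [Finset.card_eq_sum_ones, Nat.cast_sum]
      refine Finset.sum_le_sum fun j hj => ?_
      rw [Finset.mem_filter, blockLabel] at hj
      split_ifs at hj with h
      · simpa using h.le
      · simp at hj
    have h2 : ∑ j ∈ Finset.univ.filter fun j => blockLabel s w j = 0, s * w j ^ 2 ≤ s := by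
      calc _ ≤ ∑ j, s * w j ^ 2 := Finset.sum_le_sum_of_subset_of_nonneg
            (Finset.filter_subset _ _) fun j _ _ => by positivity
        _ ≤ s := by
            rw [← Finset.mul_sum]
            exact mul_le_of_le_one_right hs'.le hw
    exact_mod_cast h1.trans h2
  · calc _ ≤ (Finset.Ico (s * k) (s * k + s)).card := by
          refine Finset.card_le_card_of_injOn (fun j => (j : ℕ)) ?_
            (fun i _ j _ h => Fin.ext h)
          intro j hj
          replace hj := (Finset.mem_filter.1 (Finset.mem_coe.1 hj)).2
          rw [blockLabel] at hj
          split_ifs at hj with h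
          have hjk : (j : ℕ) / s = k := by omega
          have h1 := Nat.div_add_mod (j : ℕ) s
          have h2 := Nat.mod_lt (j : ℕ) hs
          rw [hjk] at h1
          simp only [Finset.coe_Ico, Set.mem_Ico]
          omega
      _ = s := by simp

theorem mul_sq_le_one_of_blockLabel {m s k : ℕ} {w : Fin m → ℝ} {j : Fin m}
    (hj : blockLabel s w j = k + 1) : s * w j ^ 2 ≤ 1 := by
  rw [blockLabel] at hj
  split_ifs at hj with h
  exact not_lt.1 h

/-- The partial sum of `∑ w_j X_j` over the blocks up to the `k`-th one, where `X_j` is the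
traceless part of `a_j a_j*`. -/
noncomputable def blockPartialSum {m n : ℕ} (s : ℕ) (w : Fin m → ℝ) (k : ℕ)
    (a : Fin m → Fin n → ℂ) : EuclideanSpace ℂ (Fin n × Fin n) :=
  ∑ j ∈ Finset.univ.filter fun j => blockLabel s w j ≤ k, w j • vecTraceless (a j)

theorem isVecHermitian_blockPartialSum {m n : ℕ} (s : ℕ) (w : Fin m → ℝ) (k : ℕ)
    (a : Fin m → Fin n → ℂ) : IsVecHermitian 0 (blockPartialSum s w k a) :=
  isVecHermitian_sum_smul _ _ fun _ _ => isVecHermitian_vecTraceless _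

theorem IsWellSpread.le_norm_sum_smul_sq {m n s : ℕ} {a : Fin m → Fin n → ℂ}
    (ha : IsWellSpread s a) (hs0 : 0 < s) (hs : 40 * (s + 1) ≤ n) {w : Fin m → ℝ}
    (hw : ∑ j, w j ^ 2 ≤ 1) {e : ℝ}
    (he : ∀ k < m / s + 1, -e ≤ ∑ j ∈ Finset.univ.filter fun j => blockLabel s w j = k + 1,
      w j * inner ℝ (‖blockPartialSum s w k a‖⁻¹ • blockPartialSum s w k a)
        (vecRankOne (a j))) :
    (n : ℝ) ^ 2 / 10 * ∑ j, w j ^ 2 - 2 * ((m / s + 1 : ℕ) : ℝ) ^ 2 * e ^ 2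
      ≤ ‖∑ j, w j • vecTraceless (a j)‖ ^ 2 := by
  -- The labels run over `0, …, b`, so there are `b` transitions between consecutive blocks.
  set b := m / s + 1 with hb
  set B : ℕ → EuclideanSpace ℂ (Fin n × Fin n) := fun k =>
    ∑ j ∈ Finset.univ.filter fun j => blockLabel s w j = k, w j • vecTraceless (a j) with hB
  have hS0 : blockPartialSum s w 0 a = B 0 := by simp [blockPartialSum, hB]
  have hS (k : ℕ) : blockPartialSum s w (k + 1) a = blockPartialSum s w k a + B (k + 1) := by
    simp only [blockPartialSum, hB]
    rw [← Finset.sum_union]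
    · congr 1
      ext j
      simp [Nat.le_add_one_iff]
    · rw [Finset.disjoint_filter]
      intro j _ h1 h2
      omega
  have h := half_sum_sub_le_norm_sq (S := fun k => blockPartialSum s w k a) (B := B)
    (q := fun k => (n : ℝ) ^ 2 / 5 *
      ∑ j ∈ Finset.univ.filter fun j => blockLabel s w j = k, w j ^ 2) (e := e) (b := b)
    (Nat.succ_pos _) hS0 hS (fun k => by positivity)
    (fun k _ => ha.mul_sum_sq_le hs _ (card_blockLabel_eq_le hs0 hw k) w) ?_
  · have h1 : blockPartialSum s w b a = ∑ j, w j • vecTraceless (a j) := by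
      rw [blockPartialSum, Finset.filter_true_of_mem fun j _ => blockLabel_le s w j]
    have h2 : ∑ k ∈ Finset.range (b + 1),
        ∑ j ∈ Finset.univ.filter fun j => blockLabel s w j = k, w j ^ 2 = ∑ j, w j ^ 2 :=
      Finset.sum_fiberwise_of_maps_to
        (fun j _ => Finset.mem_range.2 (Nat.lt_succ_of_le (blockLabel_le s w j))) _
    simp only [h1] at h
    rw [← Finset.mul_sum, h2] at h
    linarith
  · intro k hk
    have hin : inner ℝ (blockPartialSum s w k a) (B (k + 1)) = ‖blockPartialSum s w k a‖ *
        ∑ j ∈ Finset.univ.filter fun j => blockLabel s w j = k + 1,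
          w j * inner ℝ (‖blockPartialSum s w k a‖⁻¹ • blockPartialSum s w k a)
            (vecRankOne (a j)) := by
      rw [hB, inner_sum, Finset.mul_sum]
      refine Finset.sum_congr rfl fun j _ => ?_
      rw [real_inner_smul_right, (isVecHermitian_blockPartialSum s w k a).inner_vecTraceless,
        real_inner_smul_left]
      -- If the partial sum vanishes, so does its normalization, by `0⁻¹ = 0`.
      by_cases h0 : blockPartialSum s w k a = 0
      · simp [h0]
      · have := norm_ne_zero_iff.2 h0
        field_simp
    rw [hin]
    nlinarith [mul_le_mul_of_nonneg_left (he k hk) (norm_nonneg (blockPartialSum s w k a))]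

/-! ### Discretization of the sphere -/

/-- Rounding is towards zero, so the rounded vector stays in the unit ball, as the block size bound
requires. -/
theorem exists_int_div_near (N : ℕ) (hN : 0 < N) (t : ℝ) (ht : |t| ≤ 1) :
    ∃ z : ℤ, z ∈ Finset.Icc (-(N : ℤ)) N ∧ |t - z / N| ≤ 1 / N ∧ |(z : ℝ) / N| ≤ |t| := by
  have hN' : (0 : ℝ) < N := by exact_mod_cast hN
  obtain ⟨h1, h2⟩ := abs_le.1 ht
  have key (z : ℤ) (ha : |N * t - z| ≤ 1) (hb : |(z : ℝ)| ≤ N * |t|) :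
      z ∈ Finset.Icc (-(N : ℤ)) N ∧ |t - z / N| ≤ 1 / N ∧ |(z : ℝ) / N| ≤ |t| := by
    refine ⟨?_, ?_, ?_⟩
    · have h3 : |(z : ℝ)| ≤ N := hb.trans (mul_le_of_le_one_right hN'.le ht)
      rw [Finset.mem_Icc, ← abs_le]
      exact_mod_cast h3
    · rw [show t - z / N = (N * t - z) / N by field_simp, abs_div, abs_of_pos hN']
      gcongr
    · rw [abs_div, abs_of_pos hN', div_le_iff₀ hN', mul_comm]
      exact hb
  rcases le_total 0 t with h | h
  · have h3 : (0 : ℝ) ≤ ⌊N * t⌋ := by exact_mod_cast Int.floor_nonneg.2 (by positivity)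
    refine ⟨⌊N * t⌋, key _ ?_ ?_⟩
    · rw [abs_le]
      constructor <;> linarith [Int.floor_le (N * t), Int.lt_floor_add_one (N * t)]
    · rw [abs_of_nonneg h, abs_of_nonneg h3]
      exact Int.floor_le _
  · have h3 : (⌈N * t⌉ : ℝ) ≤ 0 := by
      exact_mod_cast Int.ceil_le.2 (by simpa using mul_nonpos_of_nonneg_of_nonpos hN'.le h)
    refine ⟨⌈N * t⌉, key _ ?_ ?_⟩
    · rw [abs_le]
      constructor <;> linarith [Int.le_ceil (N * t), Int.ceil_lt_add_one (N * t)]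
    · rw [abs_of_nonpos h, abs_of_nonpos h3]
      linarith [Int.le_ceil (N * t)]

/-- Near-orthogonality along the blocks for all vectors of a grid yields a lower bound for the
quadratic form of the Gram matrix. -/
theorem IsWellSpread.mul_norm_sq_le {m n s : ℕ} {a : Fin m → Fin n → ℂ}
    (ha : IsWellSpread s a) (hm : 0 < m) (hs0 : 0 < s) (hs : 40 * (s + 1) ≤ n)
    (he : ∀ z ∈ Fintype.piFinset fun _ : Fin m => Finset.Icc (-((40 * m : ℕ) : ℤ)) (40 * m : ℕ),
      ∑ j, ((z j : ℝ) / (40 * m : ℕ)) ^ 2 ≤ 1 → ∀ k < m / s + 1,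
      -((n : ℝ) / (10 * (m / s + 1 : ℕ))) ≤
        ∑ j ∈ Finset.univ.filter fun j =>
          blockLabel s (fun j => (z j : ℝ) / (40 * m : ℕ)) j = k + 1,
        (z j : ℝ) / (40 * m : ℕ) * inner ℝ
          (‖blockPartialSum s (fun j => (z j : ℝ) / (40 * m : ℕ)) k a‖⁻¹ •
            blockPartialSum s (fun j => (z j : ℝ) / (40 * m : ℕ)) k a) (vecRankOne (a j)))
    (v : EuclideanSpace ℝ (Fin m)) :
    (n : ℝ) ^ 2 / 36 * ‖v‖ ^ 2 ≤ ‖∑ j, v j • vecTraceless (a j)‖ ^ 2 := by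
  have hn : n ≠ 0 := by omega
  have hn' : (0 : ℝ) < n := by positivity
  have hm' : (0 : ℝ) < m := by exact_mod_cast hm
  have hunit (v : EuclideanSpace ℝ (Fin m)) (hv : ‖v‖ = 1) :
      (n : ℝ) / 6 ≤ ‖∑ j, v j • vecTraceless (a j)‖ := by
    have hv2 : ∑ j, v j ^ 2 = 1 := by
      have := EuclideanSpace.real_norm_sq_eq v
      rw [hv] at this
      simpa using this.symm
    have hvj (j : Fin m) : |v j| ≤ 1 := by
      have := PiLp.norm_apply_le v j
      rwa [hv] at this
    choose z hz1 hz2 hz3 using fun j =>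
      exists_int_div_near (40 * m) (by omega) (v j) (hvj j)
    have hw1 : ∑ j, ((z j : ℝ) / (40 * m : ℕ)) ^ 2 ≤ 1 := by
      rw [← hv2]
      exact Finset.sum_le_sum fun j _ => sq_le_sq.2 (hz3 j)
    -- Rounding changes each square by at most `2/(40m)`, in total `1/20`.
    have hw2 : 19 / 20 ≤ ∑ j, ((z j : ℝ) / (40 * m : ℕ)) ^ 2 := by
      have h (j : Fin m) : v j ^ 2 - 2 * (1 / (40 * m : ℕ)) ≤ ((z j : ℝ) / (40 * m : ℕ)) ^ 2 := by
        have h1 := hz2 j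
        have h2 := hz3 j
        set t := (z j : ℝ) / (40 * m : ℕ)
        have h3 : v j ^ 2 - t ^ 2 ≤ |v j - t| * |v j + t| := by
          rw [← abs_mul]
          exact (le_abs_self _).trans_eq (by ring_nf)
        have h4 : |v j + t| ≤ 2 := (abs_add_le _ _).trans (by linarith [hvj j])
        have h5 : |v j - t| * |v j + t| ≤ 1 / (40 * m : ℕ) * 2 := by gcongr
        linarith
      have := Finset.sum_le_sum fun j (_ : j ∈ Finset.univ) => h j
      rw [Finset.sum_sub_distrib, hv2, Finset.sum_const, Finset.card_univ, Fintype.card_fin,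
        nsmul_eq_mul] at this
      refine le_trans (le_of_eq ?_) this
      push_cast
      field_simp
      norm_num
    have h1 := ha.le_norm_sum_smul_sq hs0 hs hw1
      (he z (Fintype.mem_piFinset.2 hz1) hw1)
    have h2 : 2 * ((m / s + 1 : ℕ) : ℝ) ^ 2 * ((n : ℝ) / (10 * (m / s + 1 : ℕ))) ^ 2
        = (n : ℝ) ^ 2 / 50 := by
      have : ((m / s + 1 : ℕ) : ℝ) ≠ 0 := by positivity
      field_simp
      norm_num
    rw [h2] at h1
    -- `(1/10)(19/20) - 1/50 = 3/40 ≥ 1/16`.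
    have h3 : (n : ℝ) / 4 ≤ ‖∑ j, ((z j : ℝ) / (40 * m : ℕ)) • vecTraceless (a j)‖ := by
      refine le_of_sq_le_sq ?_ (norm_nonneg _)
      nlinarith [sq_nonneg (n : ℝ)]
    -- Undoing the rounding costs `m · (1/(40m)) · 2n = n/20`, and `n/4 - n/20 ≥ n/6`.
    have h4 : ‖∑ j, ((z j : ℝ) / (40 * m : ℕ)) • vecTraceless (a j)
        - ∑ j, v j • vecTraceless (a j)‖ ≤ n / 20 := by
      rw [← Finset.sum_sub_distrib]
      calc _ ≤ ∑ j : Fin m, 1 / (40 * m : ℕ) * (2 * (n : ℝ)) := by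
            refine norm_sum_le_of_le _ fun j _ => ?_
            rw [← sub_smul, norm_smul, Real.norm_eq_abs, abs_sub_comm]
            gcongr
            · exact hz2 j
            · exact (norm_vecTraceless_le hn _).trans (ha.norm_sq_le j)
        _ = n / 20 := by
            rw [Finset.sum_const, Finset.card_univ, Fintype.card_fin, nsmul_eq_mul]
            push_cast
            field_simp
            norm_num
    have h5 := norm_le_norm_add_norm_sub'
      (∑ j, ((z j : ℝ) / (40 * m : ℕ)) • vecTraceless (a j)) (∑ j, v j • vecTraceless (a j))
    linarith
  rcases eq_or_ne v 0 with rfl | hv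
  · simp
  have hv' : 0 < ‖v‖ := norm_pos_iff.2 hv
  have h := hunit (‖v‖⁻¹ • v) (by rw [norm_smul, norm_inv, norm_norm, inv_mul_cancel₀ hv'.ne'])
  have h2 : ∑ j, (‖v‖⁻¹ • v) j • vecTraceless (a j)
      = ‖v‖⁻¹ • ∑ j, v j • vecTraceless (a j) := by
    rw [Finset.smul_sum]
    exact Finset.sum_congr rfl fun j _ => by simp [mul_smul]
  rw [h2, norm_smul, norm_inv, norm_norm, inv_mul_eq_div, le_div_iff₀ hv'] at h
  calc (n : ℝ) ^ 2 / 36 * ‖v‖ ^ 2 = (n / 6 * ‖v‖) ^ 2 := by ring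
    _ ≤ _ := by gcongr

/-! ### Failure probabilities -/

theorem measure_biUnion_finset_le_card_mul {α ι : Type*} [MeasurableSpace α] (μ : Measure α)
    (s : Finset ι) (t : ι → Set α) {C : ℝ} (h : ∀ i ∈ s, μ (t i) ≤ ENNReal.ofReal C) :
    μ (⋃ i ∈ s, t i) ≤ ENNReal.ofReal (s.card * C) := by
  refine (measure_biUnion_finset_le s t).trans ((Finset.sum_le_sum h).trans ?_)
  rw [Finset.sum_const, nsmul_eq_mul, ENNReal.ofReal_mul (Nat.cast_nonneg _),
    ENNReal.ofReal_natCast]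

theorem isVecHermitian_normalized {n : ℕ} (a : Fin n → ℂ) :
    IsVecHermitian 1 ((∑ i, ‖a i‖ ^ 2)⁻¹ • vecRankOne a) := by
  have h := (isVecHermitian_vecRankOne a).smul (∑ i, ‖a i‖ ^ 2)⁻¹
  refine ⟨h.1, h.2.trans ?_⟩
  rw [abs_of_nonneg (by positivity)]
  exact inv_mul_le_one

/-- With `a_j` fixed, its normalized rank-one matrix has trace and Frobenius norm at most one. At `c
= 1/2` each `k ∈ T` contributes `1/2 + 1/4 ≤ 1` to the exponent. -/
theorem gaussianVectors_sum_inner_gt_le {m n s : ℕ} (j : Fin m) (T : Finset (Fin m))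
    (hj : j ∉ T) (hT : T.card ≤ s) :
    gaussianVectors m n {a | (n : ℝ) / 20 < ∑ k ∈ T,
        inner ℝ ((∑ i, ‖a j i‖ ^ 2)⁻¹ • vecRankOne (a j)) (vecRankOne (a k))}
      ≤ ENNReal.ofReal (Real.exp (s - n / 40)) := by
  have h := gaussianVectors_le_sum_inner_vecRankOne_le (n := n) (τ := 1) T
    (D := fun a => (∑ i, ‖a j i‖ ^ 2)⁻¹ • vecRankOne (a j)) (by fun_prop)
    (fun a => isVecHermitian_normalized (a j))
    (fun a => by
      rw [norm_smul, norm_vecRankOne, Real.norm_eq_abs, abs_of_nonneg (by positivity)]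
      exact inv_mul_le_one)
    (fun k hk x y => by
      have hjk : j ≠ k := fun h => hj (h ▸ hk)
      simp only [Function.update_of_ne hjk])
    (c := fun _ => 1 / 2) (fun _ _ => by norm_num) (n / 40)
  refine (measure_mono fun a ha => ?_).trans (h.trans ?_)
  · simp only [Set.mem_ofPred_eq, ← Finset.mul_sum] at ha ⊢
    linarith
  · gcongr
    rw [Finset.sum_const, nsmul_eq_mul]
    have : (T.card : ℝ) ≤ s := by exact_mod_cast hT
    norm_num
    linarith

theorem card_filter_card_le {m : ℕ} (s : ℕ) :
    ((Finset.univ : Finset (Finset (Fin m))).filter fun T => T.card ≤ s).card ≤ (m + 1) ^ s := by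
  have h : ((Finset.univ : Finset (Finset (Fin m))).filter fun T => T.card ≤ s)
      = (Finset.range (s + 1)).biUnion fun i => Finset.powersetCard i Finset.univ := by
    ext T
    simp
  rw [h]
  refine Finset.card_biUnion_le.trans ?_
  simp only [Finset.card_powersetCard, Finset.card_univ, Fintype.card_fin]
  -- Compare termwise with `(m+1)^s = ∑ m^i (s choose i)`, using `(m choose i) ≤ m^i`.
  rw [add_pow]
  refine Finset.sum_le_sum fun i hi => ?_
  rw [one_pow, mul_one]
  refine (Nat.choose_le_pow m i).trans (Nat.le_mul_of_pos_right _ (Nat.choose_pos ?_))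
  exact Nat.lt_succ_iff.1 (Finset.mem_range.1 hi)

theorem gaussianVectors_not_isWellSpread_le (m n s : ℕ) :
    gaussianVectors m n {a | ¬ IsWellSpread s a}
      ≤ ENNReal.ofReal (m * Real.exp (-n / 16)) + ENNReal.ofReal (m * Real.exp (-n / 4))
        + ENNReal.ofReal (m * ((m + 1) ^ s * Real.exp (s - n / 40))) := by
  have h1 (j : Fin m) : gaussianVectors m n {a | ∑ i, ‖a j i‖ ^ 2 < (n : ℝ) / 2}
      ≤ ENNReal.ofReal (Real.exp (-n / 16)) := by
    refine (measure_mono fun a ha => ?_).trans ((gaussianVectors_le_mul_sum_norm_sq_le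
      (c := -(1 / 4)) (by norm_num [abs_le]) (-n / 8) j).trans_eq ?_)
    · simp only [Set.mem_ofPred_eq] at ha ⊢
      linarith
    · congr 2
      ring
  have h2 (j : Fin m) : gaussianVectors m n {a | 2 * (n : ℝ) < ∑ i, ‖a j i‖ ^ 2}
      ≤ ENNReal.ofReal (Real.exp (-n / 4)) := by
    refine (measure_mono fun a ha => ?_).trans ((gaussianVectors_le_mul_sum_norm_sq_le
      (c := 1 / 2) (by norm_num) n j).trans_eq ?_)
    · simp only [Set.mem_ofPred_eq] at ha ⊢
      linarith
    · congr 2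
      ring
  have h3 (j : Fin m) : gaussianVectors m n
      (⋃ T ∈ (Finset.univ : Finset (Finset (Fin m))).filter fun T => T.card ≤ s,
        {a | j ∉ T ∧ (n : ℝ) / 20 < ∑ k ∈ T,
        inner ℝ ((∑ i, ‖a j i‖ ^ 2)⁻¹ • vecRankOne (a j)) (vecRankOne (a k))})
      ≤ ENNReal.ofReal ((m + 1) ^ s * Real.exp (s - n / 40)) := by
    refine (measure_biUnion_finset_le_card_mul _ _ _ (C := Real.exp (s - n / 40))
      fun T hT => ?_).trans ?_
    · by_cases hj : j ∈ T
      · simp [hj]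
      · simpa [hj] using gaussianVectors_sum_inner_gt_le j T hj (Finset.mem_filter.1 hT).2
    · gcongr
      exact_mod_cast card_filter_card_le s
  have hsub : {a : Fin m → Fin n → ℂ | ¬ IsWellSpread s a} ⊆
      (⋃ j ∈ Finset.univ, {a | ∑ i, ‖a j i‖ ^ 2 < (n : ℝ) / 2}) ∪
      (⋃ j ∈ Finset.univ, {a | 2 * (n : ℝ) < ∑ i, ‖a j i‖ ^ 2}) ∪
      (⋃ j ∈ Finset.univ, ⋃ T ∈ (Finset.univ : Finset (Finset (Fin m))).filter fun T => T.card ≤ s,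
        {a | j ∉ T ∧ (n : ℝ) / 20 < ∑ k ∈ T,
        inner ℝ ((∑ i, ‖a j i‖ ^ 2)⁻¹ • vecRankOne (a j)) (vecRankOne (a k))}) := by
    intro a ha
    by_contra hc
    simp only [Set.mem_union, Set.mem_iUnion, Set.mem_ofPred_eq, Finset.mem_univ, true_and,
      Finset.mem_filter, exists_prop, not_or, not_exists, not_and, not_lt] at hc
    exact ha ⟨hc.1.1, hc.1.2, fun j T hj hT => hc.2 j T hT hj⟩
  refine (measure_mono hsub).trans ((measure_union_le _ _).trans ?_)
  gcongr
  · refine (measure_union_le _ _).trans ?_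
    gcongr
    · simpa using measure_biUnion_finset_le_card_mul _ Finset.univ _ fun j _ => h1 j
    · simpa using measure_biUnion_finset_le_card_mul _ Finset.univ _ fun j _ => h2 j
  · simpa using measure_biUnion_finset_le_card_mul _ Finset.univ _ fun j _ => h3 j

@[fun_prop]
theorem measurable_vecTraceless {n : ℕ} : Measurable (vecTraceless : (Fin n → ℂ) → _) := by
  unfold vecTraceless
  fun_prop

@[fun_prop]
theorem measurable_blockPartialSum {m n s : ℕ} {w : Fin m → ℝ} {k : ℕ} :
    Measurable (blockPartialSum s w k : (Fin m → Fin n → ℂ) → _) := by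
  unfold blockPartialSum
  fun_prop

/-- The partial sum involves only vectors with label at most `k`, so it is fixed while block `k + 1`
is integrated. Being traceless it contributes no linear term. Since `√s |w_j| ≤ 1` on the block, the
coefficients `-(√s/2) w_j` are admissible, and their squares sum to at most `s/4`. -/
theorem gaussianVectors_block_inner_lt_le {m n s : ℕ} {w : Fin m → ℝ}
    (hw : ∑ j, w j ^ 2 ≤ 1) (k : ℕ) (e : ℝ) :
    gaussianVectors m n {a | ∑ j ∈ Finset.univ.filter fun j => blockLabel s w j = k + 1,
        w j * inner ℝ (‖blockPartialSum s w k a‖⁻¹ • blockPartialSum s w k a)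
          (vecRankOne (a j)) < -e}
      ≤ ENNReal.ofReal (Real.exp (s / 4 - Real.sqrt s / 2 * e)) := by
  have h := gaussianVectors_le_sum_inner_vecRankOne_le (n := n) (τ := 0)
    (Finset.univ.filter fun j => blockLabel s w j = k + 1)
    (D := fun a => ‖blockPartialSum s w k a‖⁻¹ • blockPartialSum s w k a) (by fun_prop)
    (fun a => by simpa using (isVecHermitian_blockPartialSum s w k a).smul _)
    (fun a => by
      rw [norm_smul, norm_inv, norm_norm]
      exact inv_mul_le_one)
    (fun j hj x y => by
      have : blockPartialSum s w k (Function.update x j y) = blockPartialSum s w k x := by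
        refine Finset.sum_congr rfl fun i hi => ?_
        have hij : i ≠ j := by
          rintro rfl
          have h1 := (Finset.mem_filter.1 hi).2
          have h2 := (Finset.mem_filter.1 hj).2
          omega
        rw [Function.update_of_ne hij]
      simp only [this])
    (c := fun j => -(Real.sqrt s / 2) * w j)
    (fun j hj => by
      have h1 := mul_sq_le_one_of_blockLabel (Finset.mem_filter.1 hj).2
      have h2 : |Real.sqrt s * w j| ≤ 1 := by
        rw [← sq_le_one_iff_abs_le_one, mul_pow, Real.sq_sqrt (Nat.cast_nonneg _)]
        exact h1
      rw [neg_mul, abs_neg, div_mul_eq_mul_div, abs_div, abs_two]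
      linarith)
    (Real.sqrt s / 2 * e)
  refine (measure_mono fun a ha => ?_).trans (h.trans ?_)
  · simp only [Set.mem_ofPred_eq, mul_assoc, ← Finset.mul_sum] at ha ⊢
    nlinarith [mul_le_mul_of_nonneg_left ha.le (by positivity : 0 ≤ Real.sqrt s / 2)]
  · gcongr
    have h1 : ∑ j ∈ Finset.univ.filter fun j => blockLabel s w j = k + 1, w j ^ 2 ≤ 1 :=
      (Finset.sum_le_sum_of_subset_of_nonneg (Finset.filter_subset _ _)
        fun j _ _ => sq_nonneg _).trans hw
    simp only [mul_zero, zero_add, mul_pow, neg_sq, div_pow, Real.sq_sqrt (Nat.cast_nonneg s)]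
    rw [← Finset.mul_sum]
    have h2 : (0 : ℝ) ≤ s := Nat.cast_nonneg s
    nlinarith

theorem gaussianVectors_exists_block_inner_lt_le {m n : ℕ} (s b N : ℕ) (e : ℝ) :
    gaussianVectors m n {a | ∃ z ∈ Fintype.piFinset fun _ : Fin m => Finset.Icc (-(N : ℤ)) N,
        ∑ j, ((z j : ℝ) / N) ^ 2 ≤ 1 ∧ ∃ k < b,
        ∑ j ∈ Finset.univ.filter fun j => blockLabel s (fun j => (z j : ℝ) / N) j = k + 1,
        (z j : ℝ) / N * inner ℝ
          (‖blockPartialSum s (fun j => (z j : ℝ) / N) k a‖⁻¹ •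
            blockPartialSum s (fun j => (z j : ℝ) / N) k a) (vecRankOne (a j)) < -e}
      ≤ ENNReal.ofReal
        ((2 * N + 1) ^ m * (b * Real.exp (s / 4 - Real.sqrt s / 2 * e))) := by
  have h (z : Fin m → ℤ) : gaussianVectors m n (⋃ k ∈ Finset.range b,
      {a | ∑ j, ((z j : ℝ) / N) ^ 2 ≤ 1 ∧
        ∑ j ∈ Finset.univ.filter fun j => blockLabel s (fun j => (z j : ℝ) / N) j = k + 1,
        (z j : ℝ) / N * inner ℝ
          (‖blockPartialSum s (fun j => (z j : ℝ) / N) k a‖⁻¹ •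
            blockPartialSum s (fun j => (z j : ℝ) / N) k a) (vecRankOne (a j)) < -e})
      ≤ ENNReal.ofReal (b * Real.exp (s / 4 - Real.sqrt s / 2 * e)) := by
    refine (measure_biUnion_finset_le_card_mul _ _ _
      (C := Real.exp (s / 4 - Real.sqrt s / 2 * e)) fun k _ => ?_).trans_eq ?_
    · by_cases hz : ∑ j, ((z j : ℝ) / N) ^ 2 ≤ 1
      · simpa only [hz, true_and] using gaussianVectors_block_inner_lt_le hz k e
      · simp [hz]
    · rw [Finset.card_range]
  have h2 := measure_biUnion_finset_le_card_mul (gaussianVectors m n)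
    (Fintype.piFinset fun _ : Fin m => Finset.Icc (-(N : ℤ)) N) _ fun z _ => h z
  refine (measure_mono fun a ha => ?_).trans (h2.trans_eq ?_)
  · obtain ⟨z, hz, hz1, k, hk, hlt⟩ := ha
    simp only [Set.mem_iUnion, Finset.mem_range]
    exact ⟨z, hz, k, hk, hz1, hlt⟩
  · congr 2
    rw [Fintype.card_piFinset, Finset.prod_const, Finset.card_univ, Fintype.card_fin, Int.card_Icc]
    have : ((N : ℤ) + 1 - -(N : ℤ)).toNat = 2 * N + 1 := by omega
    rw [this]
    push_cast
    rfl

/-! ### Joint law, choice of constants and conclusion -/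

theorem map_eq_gaussianVectors {m n : ℕ} {Ω : Type*} [MeasurableSpace Ω] {P : Measure Ω}
    [IsProbabilityMeasure P] {a : Fin m → Fin n → Ω → ℂ}
    (ha : ∀ j l, HasLaw (a j l) stdComplexGaussian P)
    (hind : iIndepFun (fun p : Fin m × Fin n => a p.1 p.2) P) :
    P.map (fun ω j l => a j l ω) = gaussianVectors m n := by
  have h := hind.map_fun_eq_pi_map fun p : Fin m × Fin n => (ha p.1 p.2).aemeasurable
  simp_rw [(ha _ _).map_eq] at h
  have h2 := Measure.infinitePi_map_curry (ι := Fin m) (κ := Fin n) (X := ℂ)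
    (fun _ _ => stdComplexGaussian)
  simp only [Measure.infinitePi_eq_pi] at h2
  rw [gaussianVectors, ← h2, ← h, AEMeasurable.map_map_of_aemeasurable (by fun_prop)]
  · rfl
  · exact aemeasurable_pi_lambda _ fun p : Fin m × Fin n => (ha p.1 p.2).aemeasurable

theorem mul_exp_le_exp_neg {c x y p : ℝ} (hc : c ≤ Real.exp y) (h : y + x ≤ -p) :
    c * Real.exp x ≤ Real.exp (-p) := by
  calc c * Real.exp x ≤ Real.exp y * Real.exp x := by gcongr
    _ = Real.exp (y + x) := (Real.exp_add _ _).symm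
    _ ≤ _ := Real.exp_le_exp.2 h

theorem one_le_log_mul {m : ℕ} (hm : 1 ≤ m) : 1 ≤ Real.log (545 * (m : ℝ)) := by
  have hm' : (1 : ℝ) ≤ m := by exact_mod_cast hm
  rw [Real.le_log_iff_exp_le (by positivity)]
  linarith [Real.exp_one_lt_d9]

/-- The union bound over the grid is beaten by the tail bound for blocks of size `⌈m^{7/8}⌉`. -/
theorem grid_failure_probability_le {m n s : ℕ} (hm : 1 ≤ m)
    (hn : 640 * ((m : ℝ) ^ (7 / 8 : ℝ) * Real.log (545 * (m : ℝ))) ≤ n)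
    (hs : (m : ℝ) ^ (7 / 8 : ℝ) ≤ s) (hsm : s ≤ m) :
    (2 * ((40 * m : ℕ) : ℝ) + 1) ^ m * (((m / s + 1 : ℕ) : ℝ) *
        Real.exp (s / 4 - Real.sqrt s / 2 * (n / (10 * (m / s + 1 : ℕ)))))
      ≤ Real.exp (-(m : ℝ) ^ (7 / 8 : ℝ)) := by
  have hm' : (1 : ℝ) ≤ m := by exact_mod_cast hm
  have hL := one_le_log_mul hm
  set L := Real.log (545 * (m : ℝ)) with hLdef
  set p := (m : ℝ) ^ (7 / 8 : ℝ) with hp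
  have hp1 : 1 ≤ p := Real.one_le_rpow hm' (by norm_num)
  have hpm : p ≤ m := by
    calc p ≤ (m : ℝ) ^ (1 : ℝ) := Real.rpow_le_rpow_of_exponent_le hm' (by norm_num)
      _ = m := Real.rpow_one _
  have hexpL : Real.exp L = 545 * m := Real.exp_log (by positivity)
  have hs1 : (1 : ℝ) ≤ s := hp1.trans hs
  have hsm' : (s : ℝ) ≤ m := by exact_mod_cast hsm
  set b : ℝ := ((m / s + 1 : ℕ) : ℝ) with hb
  have hb0 : 0 < b := by positivity
  have hbs : b * s ≤ 2 * m := by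
    have h1 : ((m / s : ℕ) : ℝ) * s ≤ m := by exact_mod_cast Nat.div_mul_le_self m s
    rw [hb]
    push_cast
    linarith
  have hbL : b ≤ Real.exp L := by
    rw [hexpL]
    nlinarith
  -- Here `80m + 1 ≤ 545m` is used.
  have hgrid : (2 * ((40 * m : ℕ) : ℝ) + 1) ^ m ≤ Real.exp (m * L) := by
    rw [Real.exp_nat_mul, hexpL]
    push_cast
    gcongr
    linarith
  have hsqrt : (m : ℝ) ^ (7 / 16 : ℝ) ≤ Real.sqrt s := by
    refine Real.le_sqrt_of_sq_le ?_
    rw [← Real.rpow_natCast, ← Real.rpow_mul (by positivity)]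
    norm_num
    exact hs
  -- The exponents from `√s`, `s` and `n` add up to `7/16 + 7/8 + 7/8 = 35/16`, which exceeds the
  -- required `2`.
  have hpow : (m : ℝ) ^ 2 ≤ Real.sqrt s * s * p := by
    calc (m : ℝ) ^ 2 = (m : ℝ) ^ (2 : ℝ) := (Real.rpow_natCast _ 2).symm
      _ ≤ (m : ℝ) ^ (35 / 16 : ℝ) := Real.rpow_le_rpow_of_exponent_le hm' (by norm_num)
      _ = (m : ℝ) ^ (7 / 16 : ℝ) * p * p := by
          rw [hp, ← Real.rpow_add (by positivity), ← Real.rpow_add (by positivity)]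
          norm_num
      _ ≤ _ := by gcongr
  have hmain : 16 * m * L ≤ Real.sqrt s / 2 * (n / (10 * b)) := by
    have h1 : 640 * (p * L) * (Real.sqrt s * s) ≤ n * (Real.sqrt s * s) := by gcongr
    have h2 : (m : ℝ) ^ 2 * L ≤ Real.sqrt s * s * p * L := by gcongr
    have h3 : 16 * m * L * (20 * (b * s)) ≤ 16 * m * L * (20 * (2 * m)) := by gcongr
    have h4 : 16 * m * L * (20 * b) ≤ Real.sqrt s * n := by
      refine le_of_mul_le_mul_right ?_ (by linarith : (0 : ℝ) < s)
      nlinarith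
    rw [div_mul_div_comm, le_div_iff₀ (by positivity)]
    linarith
  rw [← mul_assoc]
  refine mul_exp_le_exp_neg (y := m * L + L) ?_ ?_
  · rw [Real.exp_add]
    gcongr
  · have h1 : (m : ℝ) ≤ m * L := le_mul_of_one_le_right (by positivity) hL
    have h2 : L ≤ m * L := le_mul_of_one_le_left (by linarith) hm'
    linarith

/-- Choosing the small set costs `exp(sL)` with `sL ≤ 2 m^{7/8} L`, while `n/40 ≥ 16 m^{7/8} L`. -/
theorem spread_failure_probability_le {m n s : ℕ} (hm : 1 ≤ m)
    (hn : 640 * ((m : ℝ) ^ (7 / 8 : ℝ) * Real.log (545 * (m : ℝ))) ≤ n)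
    (hs : (s : ℝ) ≤ 2 * (m : ℝ) ^ (7 / 8 : ℝ)) :
    m * Real.exp (-n / 16) ≤ Real.exp (-(m : ℝ) ^ (7 / 8 : ℝ)) ∧
    m * Real.exp (-n / 4) ≤ Real.exp (-(m : ℝ) ^ (7 / 8 : ℝ)) ∧
    m * ((m + 1) ^ s * Real.exp (s - n / 40)) ≤ Real.exp (-(m : ℝ) ^ (7 / 8 : ℝ)) := by
  have hm' : (1 : ℝ) ≤ m := by exact_mod_cast hm
  have hL := one_le_log_mul hm
  set L := Real.log (545 * (m : ℝ)) with hLdef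
  set p := (m : ℝ) ^ (7 / 8 : ℝ) with hp
  have hp1 : 1 ≤ p := Real.one_le_rpow hm' (by norm_num)
  have hexpL : Real.exp L = 545 * m := Real.exp_log (by positivity)
  have h1 : p ≤ p * L := le_mul_of_one_le_right (by linarith) hL
  have h2 : L ≤ p * L := le_mul_of_one_le_left (by linarith) hp1
  have h3 : (m : ℝ) ≤ Real.exp L := by linarith
  refine ⟨mul_exp_le_exp_neg h3 (by linarith),
    mul_exp_le_exp_neg h3 (by linarith), ?_⟩
  rw [← mul_assoc]
  refine mul_exp_le_exp_neg (y := L + s * L) ?_ ?_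
  · rw [Real.exp_add, Real.exp_nat_mul]
    gcongr
    linarith
  · have h4 : s * L ≤ 2 * p * L := by gcongr
    linarith

/-- The probability bound is stated as an upper bound for the (outer) measure of the complement of
the event that the quotient property holds for all `κ > 0` simultaneously. -/
theorem theorem2p1 :
    ∃ c₂ > (0 : ℝ), ∃ γ₂ > (0 : ℝ), ∃ m₀ : ℕ, ∀ m n : ℕ, m₀ ≤ m →
      (m : ℝ) ≤ ((n : ℝ) / (c₂ * Real.log (545 * (m : ℝ)))) ^ (8 / 7 : ℝ) →
      ∀ (Ω : Type*) [MeasurableSpace Ω] (P : Measure Ω) [IsProbabilityMeasure P]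
        (a : Fin m → Fin n → Ω → ℂ),
        (∀ j l, HasLaw (a j l) stdComplexGaussian P) →
        iIndepFun (fun p : Fin m × Fin n => a p.1 p.2) P →
        P {ω | ¬ ∀ κ : ℝ, 0 < κ →
            HasQuotientProperty 1
              (128 * Real.sqrt 2 / κ * Real.sqrt (κ * (m : ℝ) / (n : ℝ)))
              (κ * (m : ℝ) / (n : ℝ))
              ((1 / Real.sqrt (m : ℝ)) • measurementOperator (fun j l => a j l ω))}
          ≤ ENNReal.ofReal (14 * Real.exp (-γ₂ * (m : ℝ) ^ (7 / 8 : ℝ))) := by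
  refine ⟨640, by norm_num, 1, one_pos, 1, fun m n hm hmn Ω _ P _ a ha hind => ?_⟩
  have hm' : (1 : ℝ) ≤ m := by exact_mod_cast hm
  have hL := one_le_log_mul hm
  have hp1 : 1 ≤ (m : ℝ) ^ (7 / 8 : ℝ) := Real.one_le_rpow hm' (by norm_num)
  have hpm : (m : ℝ) ^ (7 / 8 : ℝ) ≤ m := by
    calc (m : ℝ) ^ (7 / 8 : ℝ) ≤ (m : ℝ) ^ (1 : ℝ) :=
          Real.rpow_le_rpow_of_exponent_le hm' (by norm_num)
      _ = m := Real.rpow_one _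
  -- This is the dimension hypothesis raised to the power `7/8`.
  have hn : 640 * ((m : ℝ) ^ (7 / 8 : ℝ) * Real.log (545 * (m : ℝ))) ≤ n := by
    have h := Real.rpow_le_rpow (by positivity) hmn (by norm_num : (0 : ℝ) ≤ 7 / 8)
    rw [← Real.rpow_mul (by positivity)] at h
    norm_num at h
    rw [le_div_iff₀ (by positivity)] at h
    linarith
  set s := ⌈(m : ℝ) ^ (7 / 8 : ℝ)⌉₊ with hsdef
  have hs1 : (m : ℝ) ^ (7 / 8 : ℝ) ≤ s := Nat.le_ceil _
  have hs2 : (s : ℝ) ≤ 2 * (m : ℝ) ^ (7 / 8 : ℝ) := by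
    linarith [Nat.ceil_lt_add_one (by positivity : 0 ≤ (m : ℝ) ^ (7 / 8 : ℝ))]
  have hsm : s ≤ m := Nat.ceil_le.2 hpm
  have hs0 : 0 < s := Nat.ceil_pos.2 (by linarith)
  have hsn : 40 * (s + 1) ≤ n := by
    have h1 : (m : ℝ) ^ (7 / 8 : ℝ) ≤ (m : ℝ) ^ (7 / 8 : ℝ) * Real.log (545 * (m : ℝ)) :=
      le_mul_of_one_le_right (by linarith) hL
    have h2 : 40 * ((s : ℝ) + 1) ≤ n := by linarith
    exact_mod_cast h2
  have hsub : {ω | ¬ ∀ κ : ℝ, 0 < κ → HasQuotientProperty 1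
      (128 * Real.sqrt 2 / κ * Real.sqrt (κ * (m : ℝ) / (n : ℝ))) (κ * (m : ℝ) / (n : ℝ))
      ((1 / Real.sqrt (m : ℝ)) • measurementOperator (fun j l => a j l ω))} ⊆
      (fun ω j l => a j l ω) ⁻¹' ({x | ¬ IsWellSpread s x} ∪ {x | ∃ z ∈
        Fintype.piFinset fun _ : Fin m => Finset.Icc (-((40 * m : ℕ) : ℤ)) (40 * m : ℕ),
        ∑ j, ((z j : ℝ) / (40 * m : ℕ)) ^ 2 ≤ 1 ∧ ∃ k < m / s + 1,
        ∑ j ∈ Finset.univ.filter fun j =>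
          blockLabel s (fun j => (z j : ℝ) / (40 * m : ℕ)) j = k + 1,
        (z j : ℝ) / (40 * m : ℕ) * inner ℝ
          (‖blockPartialSum s (fun j => (z j : ℝ) / (40 * m : ℕ)) k x‖⁻¹ •
            blockPartialSum s (fun j => (z j : ℝ) / (40 * m : ℕ)) k x) (vecRankOne (x j))
          < -((n : ℝ) / (10 * (m / s + 1 : ℕ)))}) := by
    intro ω hω
    by_contra hc
    rw [Set.mem_preimage, Set.mem_union, not_or] at hc
    obtain ⟨hw, he⟩ := hc
    replace hw := not_not.1 hw
    simp only [Set.mem_ofPred_eq, not_exists, not_and, not_lt] at he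
    exact hω fun κ hκ => hasQuotientProperty_measurementOperator hm (by omega) _ hw.norm_sq_le
      (hw.mul_norm_sq_le hm hs0 hsn he) hκ
  have hmeas : AEMeasurable (fun ω j l => a j l ω) P :=
    aemeasurable_pi_lambda _ fun j => aemeasurable_pi_lambda _ fun l => (ha j l).aemeasurable
  obtain ⟨h1, h2, h3⟩ := spread_failure_probability_le hm hn hs2
  have h4 := grid_failure_probability_le hm hn hs1 hsm
  -- `Measure.le_map_apply` needs no measurability of the bad set.
  refine (measure_mono hsub).trans ((Measure.le_map_apply hmeas _).trans ?_)
  rw [map_eq_gaussianVectors ha hind]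
  refine (measure_union_le _ _).trans ((add_le_add (gaussianVectors_not_isWellSpread_le m n s)
    (gaussianVectors_exists_block_inner_lt_le s (m / s + 1) (40 * m) _)).trans ?_)
  refine (add_le_add (add_le_add (add_le_add (ENNReal.ofReal_le_ofReal h1)
    (ENNReal.ofReal_le_ofReal h2)) (ENNReal.ofReal_le_ofReal h3))
    (ENNReal.ofReal_le_ofReal h4)).trans ?_
  rw [← ENNReal.ofReal_add (by positivity) (by positivity),
    ← ENNReal.ofReal_add (by positivity) (by positivity),
    ← ENNReal.ofReal_add (by positivity) (by positivity), neg_one_mul]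
  refine ENNReal.ofReal_le_ofReal ?_
  -- Four failure terms of size `exp(-m^{7/8})` fit below the factor `14`.
  linarith [Real.exp_pos (-(m : ℝ) ^ (7 / 8 : ℝ))]
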